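/- **Proposition 2 (Convergence of min-sum belief propagation for balanced routing).** Let $G=(\mathcal V,\mathcal E)$ be a finite directed graph without self-loops, with $\mathcal E\subseteq \mathcal V\times\mathcal V$ and $\mathcal V=\mathcal V_{\rm s}\sqcup\mathcal V_{\rm d}$, the nodes of $\mathcal V_{\rm d}$ being the destinations. For $i\in\mathcal V$ let $\mathcal E_i^{\rm out}$ and $\mathcal E_i^{\rm in}$ be the sets of edges leaving and entering $i$, and $\mathcal E_i=\mathcal E_i^{\rm out}\cup\mathcal E_i^{\rm in}$. Let $r_i\in\mathbb N=\{0,1,2,\dots\}$ for $i\in\mathcal V_{\rm s}$, let $u_e\in\mathbb N_{>0}$ and $c_e>0$ for $e\in\mathcal E$, and let $w\in[0,1]$. For each $i\in\mathcal V_{\rm s}$ let $\phi_i:[0,\infty)\to\mathbb R$ be strictly increasing, convex, and piecewise linear with integral breakpoints (affine on $[k,k+1]$ for every $k\in\mathbb N$). Consider the problem $$\min_{\mathbf x\in\mathbb R^{\mathcal E}}\ (1-w)\sum_{e\in\mathcal E}c_ex_e+w\sum_{i\in\mathcal V_{\rm s}}\phi_i\Big(\sum_{e\in\mathcal E_i^{\rm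 out}}x_e\Big)$$ subject to $$\sum_{e\in\mathcal E_i^{\rm out}}x_e-\sum_{e\in\mathcal E_i^{\rm in}}x_e=r_i\ \ (i\in\mathcal V_{\rm s}),\qquad 0\le x_e\le u_e\ \ (e\in\mathcal E).$$ Let $g_e(z)=(1-w)c_ez$ if $0\le z\le u_e$ and $g_e(z)=\infty$ otherwise. For $i\in\mathcal V_{\rm s}$ and $\mathbf z\in\mathbb R_{+}^{\mathcal E_i}$ let $f_i(\mathbf z)=w\,\phi_i\big(\sum_{e\in\mathcal E_i^{\rm out}}z_e\big)$ if $\sum_{e\in\mathcal E_i^{\rm out}}z_e-\sum_{e\in\mathcal E_i^{\rm in}}z_e=r_i$, and $f_i(\mathbf z)=\infty$ otherwise. The algorithm sets $m^0_{i\to e}=g_e$ for all $i\in\mathcal V$, $e\in\mathcal E_i$. For $t\ge1$, it updates, for $i\in\mathcal V_{\rm s}$ and $e\in\mathcal E_i$, $$m^t_{i\to e}(z)=g_e(z)+\min_{\tilde{\mathbf z}\in\mathbb R_+^{\mathcal E_i}:\ \tilde z_e=z}\Big\{f_i(\tilde{\mathbf z})+\sum_{e'\in\mathcal E_i\setminus\{e\}}m^{t-1}_{k(e')\to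 e'}(\tilde z_{e'})\Big\},$$ where $k(e')$ is the endpoint of $e'$ other than $i$ (the minimum being $\infty$ if there is no admissible $\tilde{\mathbf z}$), while $m^t_{i\to e}=m^{t-1}_{i\to e}$ for $i\in\mathcal V_{\rm d}$. For $e=(i,j)\in\mathcal E$ the belief is $b^t_e(z)=m^t_{i\to e}(z)+m^t_{j\to e}(z)-g_e(z)$ for $z\in[0,u_e]$, and $b_e^t(z)=\infty$ for other $z$. The output after $t$ iterations is $\hat{\mathbf x}^t=(\hat x^t_e)_{e\in\mathcal E}$ with $\hat x^t_e\in\operatorname{arg\,min}_z b^t_e(z)$. Suppose that the problem has a unique optimal solution $\mathbf x^\ast$. Then there is a finite integer $T^\ast$ such that $\hat{\mathbf x}^t=\mathbf x^\ast$ for all $t\ge T^\ast$; that is, for every $t\ge T^\ast$ and every $e\in\mathcal E$, $x_e^\ast$ is the unique minimizer of $b_e^t$. -/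

import Mathlib

/-- `φ` is piecewise linear on `[0, ∞)` with all breakpoints integral: it is affine on every
interval `[k, k + 1]`, `k = 0, 1, 2, …`. -/
def PiecewiseLinearIntegral (φ : ℝ → ℝ) : Prop :=
  ∀ k : ℕ, ∃ a b : ℝ, ∀ y ∈ Set.Icc (k : ℝ) (k + 1), φ y = a * y + b

/-- An instance of the balanced routing problem on a finite directed graph with node set `V`.
The nodes outside `Vs` are the destinations; for those the fields `rate` and `penalty` play no
role and are unrestricted. -/
structure RoutingNetwork (V : Type*) [Fintype V] [DecidableEq V] where
  /-- the nodes that generate or relay traffic -/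
  Vs : Finset V
  /-- the directed edges; `(i, j)` means that `i` can transmit to `j` -/
  edges : Finset (V × V)
  loopless : ∀ p ∈ edges, p.1 ≠ p.2
  /-- the rates `r_i` -/
  rate : V → ℕ
  /-- the capacities `u_e` -/
  cap : edges → ℕ
  cap_pos : ∀ e, 0 < cap e
  /-- the edge costs `c_e` -/
  cost : edges → ℝ
  cost_pos : ∀ e, 0 < cost e
  /-- the load penalties `φ_i`, of which only the values on `[0, ∞)` matter -/
  penalty : V → ℝ → ℝ
  penalty_strictMono : ∀ i ∈ Vs, StrictMonoOn (penalty i) (Set.Ici 0)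
  penalty_convex : ∀ i ∈ Vs, ConvexOn ℝ (Set.Ici 0) (penalty i)
  penalty_piecewiseLinear : ∀ i ∈ Vs, PiecewiseLinearIntegral (penalty i)
  /-- the trade-off parameter -/
  w : ℝ
  w_nonneg : 0 ≤ w
  w_le_one : w ≤ 1

namespace RoutingNetwork

variable {V : Type*} [Fintype V] [DecidableEq V] (N : RoutingNetwork V)

/-- The type of edges of the network. -/
abbrev Edge : Type _ := N.edges

/-- The edges leaving `i`. -/
def outEdges (i : V) : Finset N.Edge := Finset.univ.filter fun e => e.1.1 = i

/-- The edges entering `i`. -/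
def inEdges (i : V) : Finset N.Edge := Finset.univ.filter fun e => e.1.2 = i

/-- All edges incident to `i`. -/
def incEdges (i : V) : Finset N.Edge := N.outEdges i ∪ N.inEdges i

/-- The endpoint other than `i` of an edge incident to `i`. -/
def otherEnd (i : V) (e : N.Edge) : V := if e.1.1 = i then e.1.2 else e.1.1

/-- The load of node `i` under the flow `x`. -/
def load (x : N.Edge → ℝ) (i : V) : ℝ := ∑ e ∈ N.outEdges i, x e

/-- Flow conservation at node `i`. -/
def Conserves (x : N.Edge → ℝ) (i : V) : Prop :=
  ∑ e ∈ N.outEdges i, x e - ∑ e ∈ N.inEdges i, x e = (N.rate i : ℝ)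

/-- Feasible flows: conservation at the nodes of `Vs`, and the capacity constraints. -/
def Feasible (x : N.Edge → ℝ) : Prop :=
  (∀ i ∈ N.Vs, N.Conserves x i) ∧ ∀ e, 0 ≤ x e ∧ x e ≤ (N.cap e : ℝ)

/-- The objective function of the balanced routing problem. -/
noncomputable def objective (x : N.Edge → ℝ) : ℝ :=
  (1 - N.w) * ∑ e, N.cost e * x e + N.w * ∑ i ∈ N.Vs, N.penalty i (N.load x i)

/-- `x` is an optimal solution of the balanced routing problem. -/
def IsOptimal (x : N.Edge → ℝ) : Prop :=
  N.Feasible x ∧ ∀ y, N.Feasible y → N.objective x ≤ N.objective y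

open Classical in
/-- The edge function `g_e`: linear cost on `[0, u_e]`, and `∞` elsewhere. -/
noncomputable def edgeFun (e : N.Edge) (z : ℝ) : EReal :=
  if 0 ≤ z ∧ z ≤ (N.cap e : ℝ) then (((1 - N.w) * N.cost e * z : ℝ) : EReal) else ⊤

open Classical in
/-- The node function `f_i`, which depends only on the flows on the edges incident to `i`:
the load penalty together with the conservation constraint for `i ∈ Vs`, and zero for the
destinations. -/
noncomputable def nodeFun (i : V) (y : N.Edge → ℝ) : EReal :=
  if i ∈ N.Vs then
    (if N.Conserves y i then 0 else ⊤) + ((N.w * N.penalty i (N.load y i) : ℝ) : EReal)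
  else 0

/-- The message `m_{i → e}^t`, for an edge `e` incident to `i`. The minimum in the update is over
nonnegative flows `y` with `y e = z`; only the coordinates of `y` on the edges incident to `i`
enter. It is written as an infimum in the extended reals (`∞` if no such `y` is admissible).
Messages computed by destinations are never updated. -/
noncomputable def message : ℕ → V → N.Edge → ℝ → EReal
  | 0, _, e, z => N.edgeFun e z
  | t + 1, i, e, z =>
      if i ∈ N.Vs then
        N.edgeFun e z +
          ⨅ (y : N.Edge → ℝ) (_ : (∀ e', 0 ≤ y e') ∧ y e = z),
            (N.nodeFun i y +
              ∑ e' ∈ (N.incEdges i).erase e, message t (N.otherEnd i e') e' (y e'))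
      else message t i e z

open Classical in
/-- The belief `b_e^t = m_{i → e}^t + m_{j → e}^t - g_e` of the edge `e = (i, j)`. Outside
`[0, u_e]`, where all three terms are `∞`, the belief is `∞`. -/
noncomputable def belief (t : ℕ) (e : N.Edge) (z : ℝ) : EReal :=
  if 0 ≤ z ∧ z ≤ (N.cap e : ℝ) then
    N.message t e.1.1 e z + N.message t e.1.2 e z - N.edgeFun e z
  else ⊤

/-- `x` is an output of the algorithm run for `t` iterations: each `x e` is a global minimizer
of the belief of `e`. -/
def IsOutput (t : ℕ) (x : N.Edge → ℝ) : Prop :=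
  ∀ e z, N.belief t e (x e) ≤ N.belief t e z

end RoutingNetwork

/-! Split every node of `Vs` into an internal edge carrying its load, so that penalties become edge
costs with one-sided marginal costs, and merge all destinations into one vertex `D`. When the flow
on an edge `e` leaves its optimal value, each message update moves the excess on at a node: either
through the node to edges on the opposite side, or onto other edges of the same side, changed in the
opposite direction. It never returns along `e` and it stops at destinations. So the growth rate of a
message is bounded below by weights of non-backtracking residual walks.

By uniqueness, residual circulations have nonnegative cost, and those of zero cost cancel on every
edge: otherwise pushing a little flow along one would give a better or a second optimum
(`circulationsPos_of_unique`). Hence closed residual walks that backtrack at most at `D` have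
positive weight (`sum_pos_of_periodic_walk`); elsewhere backtracking must be excluded, because an
edge traversed both ways costs nothing. Finiteness then gives a potential with slack `ε` per step
(`exists_nonBacktracking_potential`).

Walks that have not yet ended weigh about `ε * t`, and walks between destinations close up at `D`,
so they weigh at least `ε`. Thus after finitely many iterations the rates of the two messages on `e`
sum to more than the marginal cost of `e`, which is what subtracting `g_e` removes
(`exists_step_bounds`, `exists_isSlopeBound`). Rerouting at a node transfers these bounds to the
messages (`exists_updateCost_add_le`, `message_add_le`), and each belief has its strict minimum at
the optimal flow. -/

/-! ### Potentials on finite weighted digraphs -/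

-- A walk longer than the number of vertices contains a short closed subwalk, by pigeonhole. Cutting
-- it out does not increase the weight, so only short walks matter.
open Finset in
theorem exists_walk_weight_lower_bound {A : Type*} [Fintype A] (R : A → A → Prop) (c : A → ℝ)
    (hnonneg : ∀ (a : ℕ → A) (L : ℕ), 0 < L → L ≤ Fintype.card A →
      (∀ k < L, R (a k) (a (k + 1))) → a L = a 0 → 0 ≤ ∑ k ∈ range L, c (a k)) :
    ∃ B : ℝ, ∀ (a : ℕ → A) (L : ℕ), (∀ k < L, R (a k) (a (k + 1))) →
      B ≤ ∑ k ∈ range L, c (a k) := by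
  classical
  refine ⟨-(Fintype.card A * ∑ x, |c x|), fun a L => ?_⟩
  induction L using Nat.strong_induction_on generalizing a with
  | _ L ih =>
  intro hw
  have hM : ∀ x, -∑ x, |c x| ≤ c x := fun x =>
    (neg_le_neg (single_le_sum (f := fun x => |c x|) (fun _ _ => abs_nonneg _)
      (mem_univ x))).trans (neg_abs_le _)
  have hM0 : 0 ≤ ∑ x, |c x| := sum_nonneg fun _ _ => abs_nonneg _
  by_cases hL : L ≤ Fintype.card A
  · calc -((Fintype.card A : ℝ) * ∑ x, |c x|) ≤ -((L : ℝ) * ∑ x, |c x|) := by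
          have : (L : ℝ) ≤ Fintype.card A := by exact_mod_cast hL
          nlinarith
      _ = ∑ k ∈ range L, (-∑ x, |c x|) := by simp
      _ ≤ _ := sum_le_sum fun k _ => hM _
  · push Not at hL
    obtain ⟨i, j, hij, hj, haij⟩ : ∃ i j, i < j ∧ j ≤ Fintype.card A ∧ a i = a j := by
      obtain ⟨i, hi, j, hj, hne, h⟩ := exists_ne_map_eq_of_card_lt_of_maps_to
        (s := range (Fintype.card A + 1)) (t := (univ : Finset A)) (f := a) (by simp)
        (fun _ _ => by simp)
      simp only [mem_range] at hi hj
      rcases lt_or_gt_of_ne hne with h' | h'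
      · exact ⟨i, j, h', by omega, h⟩
      · exact ⟨j, i, h', by omega, h.symm⟩
    have hcyc := hnonneg (fun k => a (i + k)) (j - i) (by omega) (by omega)
      (fun k hk => hw (i + k) (by omega)) (by simp [Nat.add_sub_cancel' hij.le, haij])
    have hrest := ih (i + (L - j)) (by omega) (fun k => if k < i then a k else a (k + (j - i)))
      (fun k hk => by
        rcases lt_trichotomy (k + 1) i with h | h | h
        · rw [if_pos (by omega), if_pos h]; exact hw k (by omega)
        · rw [if_pos (by omega), if_neg (by omega), h, Nat.add_sub_cancel' hij.le, ← haij, ← h]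
          exact hw k (by omega)
        · rw [if_neg (by omega), if_neg (by omega), Nat.add_right_comm]
          exact hw _ (by omega))
    refine hrest.trans ?_
    rw [sum_range_add]
    have h1 : ∑ k ∈ range i, c (if k < i then a k else a (k + (j - i)))
        = ∑ k ∈ range i, c (a k) :=
      sum_congr rfl fun k hk => by rw [if_pos (mem_range.1 hk)]
    have h2 : ∑ k ∈ range (L - j), c (if i + k < i then a (i + k) else a (i + k + (j - i)))
        = ∑ k ∈ range (L - j), c (a (j + k)) :=
      sum_congr rfl fun k hk => by rw [if_neg (by omega)]; congr 2; omega
    have h3 : L = i + (j - i) + (L - j) := by omega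
    rw [h1, h2]
    conv_rhs => rw [h3, sum_range_add, sum_range_add, Nat.add_sub_cancel' hij.le]
    linarith

open Finset in
/-- A finite weighted digraph whose closed walks have positive weight has a potential with
uniformly positive slack. -/
theorem exists_potential_of_closed_walks_pos {A : Type*} [Finite A] (R : A → A → Prop) (c : A → ℝ)
    (hpos : ∀ (a : ℕ → A) (L : ℕ), 0 < L → (∀ k < L, R (a k) (a (k + 1))) → a L = a 0 →
      0 < ∑ k ∈ range L, c (a k)) :
    ∃ ε > 0, ∃ ρ : A → ℝ, ∀ a b, R a b → ε + ρ b - ρ a ≤ c a := by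
  classical
  have := Fintype.ofFinite A
  obtain ⟨η, hη, hmin⟩ : ∃ η > 0, ∀ (a : ℕ → A) (L : ℕ), 0 < L → L ≤ Fintype.card A →
      (∀ k < L, R (a k) (a (k + 1))) → a L = a 0 → η ≤ ∑ k ∈ range L, c (a k) := by
    -- Short closed walks have only finitely many possible weights, so the positive ones have a
    -- least element.
    let S : Finset ℝ := (univ.image fun p : (Fin (Fintype.card A) → A) × Fin (Fintype.card A + 1) =>
      ∑ k, if k.1 < p.2.1 then c (p.1 k) else 0).filter (0 < ·)
    have hS : ∀ (a : ℕ → A) (L : ℕ), 0 < L → L ≤ Fintype.card A →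
        (∀ k < L, R (a k) (a (k + 1))) → a L = a 0 → ∑ k ∈ range L, c (a k) ∈ S := by
      intro a L hL hLn hw hc
      refine mem_filter.2 ⟨mem_image.2 ⟨(fun k => a k, ⟨L, by omega⟩), mem_univ _, ?_⟩,
        hpos a L hL hw hc⟩
      rw [Fin.sum_univ_eq_sum_range (fun k => if k < L then c (a k) else 0), ← sum_filter]
      congr 1
      ext k
      simp only [mem_filter, mem_range]
      omega
    rcases S.eq_empty_or_nonempty with h | h
    · exact ⟨1, one_pos, fun a L h1 h2 h3 h4 => by simpa [h] using hS a L h1 h2 h3 h4⟩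
    · exact ⟨S.min' h, (mem_filter.1 (S.min'_mem h)).2,
        fun a L h1 h2 h3 h4 => S.min'_le _ (hS a L h1 h2 h3 h4)⟩
  rcases isEmpty_or_nonempty A with hA | hA
  · exact ⟨1, one_pos, fun _ => 0, fun a => hA.elim a⟩
  have hn : (0 : ℝ) < Fintype.card A := by exact_mod_cast Fintype.card_pos
  -- Lowering every weight by this `ε` keeps closed walks of length at most `Fintype.card A`
  -- nonnegative.
  set ε := η / Fintype.card A with hε
  obtain ⟨B, hB⟩ := exists_walk_weight_lower_bound R (fun a => c a - ε) (by
    intro a L hL hLn hw hc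
    have h1 := hmin a L hL hLn hw hc
    have h2 : (L : ℝ) * ε ≤ η := by
      rw [hε, mul_div_assoc', div_le_iff₀ hn, mul_comm]
      exact mul_le_mul_of_nonneg_left (by exact_mod_cast hLn) hη.le
    simp only [sum_sub_distrib, sum_const, card_range, nsmul_eq_mul]
    linarith)
  -- The potential at `b` is the infimum of the reduced weights of walks ending at `b`, the last
  -- vertex not counted.
  let W : A → Set ℝ := fun b => {r | ∃ (a : ℕ → A) (L : ℕ), (∀ k < L, R (a k) (a (k + 1))) ∧
    a L = b ∧ r = ∑ k ∈ range L, (c (a k) - ε)}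
  have hbdd : ∀ b, BddBelow (W b) := fun b => ⟨B, by
    rintro _ ⟨a, L, hw, -, rfl⟩
    exact hB a L hw⟩
  have hne : ∀ b, (W b).Nonempty := fun b => ⟨0, fun _ => b, 0, by simp, rfl, by simp⟩
  refine ⟨ε, div_pos hη hn, fun b => sInf (W b), fun x y hxy => ?_⟩
  have : sInf (W y) - (c x - ε) ≤ sInf (W x) := by
    refine le_csInf (hne x) ?_
    rintro _ ⟨a, L, hw, hL, rfl⟩
    rw [sub_le_iff_le_add]
    refine csInf_le (hbdd y) ⟨fun k => if k ≤ L then a k else y, L + 1, fun k hk => ?_, by simp, ?_⟩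
    · beta_reduce
      rcases Nat.lt_succ_iff_lt_or_eq.1 hk with h | h
      · rw [if_pos h.le, if_pos (by omega)]; exact hw k h
      · rw [if_pos h.le, if_neg (by omega), h, hL]; exact hxy
    · beta_reduce
      rw [sum_range_succ, if_pos le_rfl, hL]
      congr 1
      exact sum_congr rfl fun k hk => by rw [if_pos (mem_range.1 hk).le]
  dsimp only
  linarith

/-! ### Circulations and non-backtracking walks -/

section DirectedArcs

variable {U P : Type*}

/-- The tail of an arc of a directed graph: `(u, true)` traverses `u` forwards and `(u, false)`
backwards. -/
def arcTail (src dst : U → P) (a : U × Bool) : P := if a.2 then src a.1 else dst a.1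

/-- The head of an arc. -/
def arcHead (src dst : U → P) (a : U × Bool) : P := if a.2 then dst a.1 else src a.1

/-- The reversed arc. -/
def arcRev (a : U × Bool) : U × Bool := (a.1, !a.2)

theorem arcTail_arcRev (src dst : U → P) (a : U × Bool) :
    arcTail src dst (arcRev a) = arcHead src dst a := by
  obtain ⟨u, _ | _⟩ := a <;> simp [arcTail, arcHead, arcRev]

theorem arcRev_ne (a : U × Bool) : arcRev a ≠ a := by
  obtain ⟨u, _ | _⟩ := a <;> simp [arcRev]

/-- The consecutive arcs of a walk that does not backtrack, except possibly at the vertex `D`. -/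
def NonBacktracking (src dst : U → P) (D : P) (res : U × Bool → Prop) (a b : U × Bool) : Prop :=
  res a ∧ res b ∧ arcHead src dst a = arcTail src dst b ∧ (b ≠ arcRev a ∨ arcHead src dst a = D)

/-- Residual circulations have nonnegative cost, and those of zero cost cancel on every edge. -/
def CirculationsPos [Fintype U] (src dst : U → P) (res : U × Bool → Prop) (c : U × Bool → ℝ) :
    Prop :=
  ∀ p : U × Bool → ℝ, (∀ a, 0 ≤ p a) → (∀ a, p a ≠ 0 → res a) →
    (∀ g : P → ℝ, ∑ a, p a * (g (arcHead src dst a) - g (arcTail src dst a)) = 0) →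
    0 ≤ ∑ a, p a * c a ∧ (∑ a, p a * c a = 0 → ∀ u, p (u, true) = p (u, false))

open Finset in
theorem sum_visits_mul {A : Type*} [Fintype A] [DecidableEq A] (f : ℕ → A) (I : Finset ℕ)
    (F : A → ℝ) : ∑ a, (∑ k ∈ I, if f k = a then (1 : ℝ) else 0) * F a = ∑ k ∈ I, F (f k) := by
  simp_rw [sum_mul]
  rw [sum_comm]
  exact sum_congr rfl fun k _ => by simp

-- Cut the closed walk at its first repeated vertex. The simple cycle and the remainder are both
-- circulations, so neither has negative cost. If the cycle had cost zero it would contain an arc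
-- and its reverse; being simple, it would then backtrack at an interior vertex other than `D`.
open Finset in
theorem sum_pos_of_periodic_walk [Fintype U] (src dst : U → P) (D : P)
    (res : U × Bool → Prop) (c : U × Bool → ℝ) (H : CirculationsPos src dst res c)
    (a : ℕ → U × Bool) (L : ℕ) (hL : 0 < L) (hper : a L = a 0)
    (hw : ∀ k, NonBacktracking src dst D res (a k) (a (k + 1)))
    (hD : arcTail src dst (a 0) = D ∨ ∀ k, arcTail src dst (a k) ≠ D) :
    0 < ∑ k ∈ range L, c (a k) := by
  classical
  set v : ℕ → P := fun k => arcTail src dst (a k) with hv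
  have hhead : ∀ k, arcHead src dst (a k) = v (k + 1) := fun k => (hw k).2.2.1
  have hex : ∃ b, ∃ i < b, v i = v b := ⟨L, 0, hL, by simp [hv, hper]⟩
  obtain ⟨b, ⟨i, hib, hvib⟩, hfirst⟩ : ∃ b, (∃ i < b, v i = v b) ∧
      ∀ b' < b, ¬ ∃ i < b', v i = v b' :=
    ⟨Nat.find hex, Nat.find_spec hex, fun b' h => Nat.find_min hex h⟩
  have hbL : b ≤ L := by
    by_contra h
    exact hfirst L (by omega) ⟨0, hL, by simp [hv, hper]⟩
  have hinj : ∀ k < b, ∀ l < b, v k = v l → k = l := by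
    intro k hk l hl h
    rcases lt_trichotomy k l with h' | h' | h'
    · exact (hfirst l hl ⟨k, h', h⟩).elim
    · exact h'
    · exact (hfirst k hk ⟨l, h', h.symm⟩).elim
  let q : Finset ℕ → U × Bool → ℝ := fun I x => ∑ k ∈ I, if a k = x then (1 : ℝ) else 0
  have hq0 : ∀ I x, 0 ≤ q I x := fun I x => sum_nonneg fun k _ => by split_ifs <;> simp
  have hqres : ∀ I x, q I x ≠ 0 → res x := by
    intro I x h
    obtain ⟨k, -, hk⟩ := exists_ne_zero_of_sum_ne_zero h
    have : a k = x := by by_contra h'; simp [h'] at hk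
    exact this ▸ (hw k).1
  have hqsum : ∀ I (F : U × Bool → ℝ), ∑ x, q I x * F x = ∑ k ∈ I, F (a k) :=
    fun I F => sum_visits_mul a I F
  have hsub : Ico i b ⊆ range L := fun k hk => mem_range.2 (by rw [mem_Ico] at hk; omega)
  have htel1 : ∀ g : P → ℝ, ∑ k ∈ Ico i b, (g (v (k + 1)) - g (v k)) = 0 := fun g => by
    rw [sum_Ico_eq_sub _ hib.le, sum_range_sub (fun k => g (v k)),
      sum_range_sub (fun k => g (v k)), hvib]
    ring
  have htel2 : ∀ g : P → ℝ, ∑ k ∈ range L \ Ico i b, (g (v (k + 1)) - g (v k)) = 0 := fun g => by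
    have h1 := sum_sdiff hsub (f := fun k => g (v (k + 1)) - g (v k))
    rw [htel1, sum_range_sub (fun k => g (v k))] at h1
    simpa [hv, hper] using h1
  have hcirc1 := H (q (Ico i b)) (hq0 _) (hqres _) (fun g => by
    rw [hqsum _ (fun x => g (arcHead src dst x) - g (arcTail src dst x))]
    simpa only [hhead] using htel1 g)
  have hcirc2 := H (q (range L \ Ico i b)) (hq0 _) (hqres _) (fun g => by
    rw [hqsum _ (fun x => g (arcHead src dst x) - g (arcTail src dst x))]
    simpa only [hhead] using htel2 g)
  rw [hqsum] at hcirc1 hcirc2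
  rw [← sum_sdiff hsub]
  refine add_pos_of_nonneg_of_pos hcirc2.1 (lt_of_le_of_ne hcirc1.1 fun h0 => ?_)
  have hnet := hcirc1.2 h0.symm (a i).1
  have hone : q (Ico i b) (a i) = 1 := by
    have : ∀ k ∈ Ico i b, (if a k = a i then (1 : ℝ) else 0) = if k = i then 1 else 0 := by
      intro k hk
      rw [mem_Ico] at hk
      refine if_congr ⟨fun h => hinj k hk.2 i hib (by simp [hv, h]), fun h => by rw [h]⟩ rfl rfl
    simp only [q]
    rw [sum_congr rfl this]
    simp [hib]
  -- A reverse of `a i` in the cycle could only be the next arc, so the turn would be at `D`. But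
  -- `D` is either the initial vertex, not repeated before time `b`, or never visited.
  have hzero : q (Ico i b) (arcRev (a i)) = 0 := by
    refine sum_eq_zero fun k hk => if_neg fun h => ?_
    rw [mem_Ico] at hk
    have hki : k ≠ i := fun hki => arcRev_ne (a i) (by rw [← h, hki])
    have hvk : v k = v (i + 1) := by rw [← hhead, ← arcTail_arcRev, ← h]
    have hk1 : k = i + 1 := hinj k hk.2 (i + 1) (by omega) hvk
    rcases (hw i).2.2.2 with h' | h'
    · exact h' (by rw [← h, hk1])
    · rw [hhead, ← hvk] at h'
      rcases hD with hD | hD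
      · have := hinj k hk.2 0 (by omega) (h'.trans hD.symm)
        omega
      · exact hD k h'
  have hx : ∀ x : U × Bool, q (Ico i b) (x.1, true) = q (Ico i b) (x.1, false) →
      q (Ico i b) x = q (Ico i b) (arcRev x) := by
    rintro ⟨u, _ | _⟩ h
    · exact h.symm
    · exact h
  have := hx _ hnet
  rw [hone, hzero] at this
  exact one_ne_zero this

open Finset in
theorem exists_nonBacktracking_potential [Fintype U] (src dst : U → P) (D : P)
    (res : U × Bool → Prop) (c : U × Bool → ℝ) (H : CirculationsPos src dst res c) :
    ∃ ε > 0, ∃ ρ : U × Bool → ℝ, ∀ a b, NonBacktracking src dst D res a b →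
      ε + ρ b - ρ a ≤ c a := by
  classical
  refine exists_potential_of_closed_walks_pos _ c fun a L hL hw hper => ?_
  let f : ℕ → U × Bool := fun k => a (k % L)
  have hfper : ∀ k, f (k + L) = f k := fun k => by simp [f]
  have hf : ∀ k, NonBacktracking src dst D res (f k) (f (k + 1)) := by
    intro k
    have hk := Nat.mod_lt k hL
    have h := hw (k % L) hk
    simp only [f]
    rcases Nat.lt_or_ge (k % L + 1) L with h' | h'
    · rwa [Nat.add_mod, Nat.mod_eq_of_lt (show 1 < L by omega), Nat.mod_eq_of_lt h']
    · have h1 : k % L + 1 = L := by omega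
      have h2 : (k + 1) % L = 0 := by
        rw [← Nat.mod_add_mod, h1, Nat.mod_self]
      have h3 : a 0 = a (k % L + 1) := by rw [h1, hper]
      rwa [h2, h3]
  have hsum : ∑ k ∈ range L, c (a k) = ∑ k ∈ range L, c (f k) :=
    sum_congr rfl fun k hk => by simp only [f]; rw [Nat.mod_eq_of_lt (mem_range.1 hk)]
  have hshift : ∀ s, ∑ k ∈ range L, c (f (k + s)) = ∑ k ∈ range L, c (f k) := by
    intro s
    induction s with
    | zero => simp
    | succ s ih =>
      rw [← ih]
      have h1 := sum_range_succ (fun k => c (f (k + s))) L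
      have h2 := sum_range_succ' (fun k => c (f (k + s))) L
      have h3 : f (L + s) = f (0 + s) := by rw [add_comm, hfper, zero_add]
      rw [h1, h3] at h2
      simp only [show ∀ k, k + 1 + s = k + (s + 1) by intro k; omega] at h2
      linarith
  rw [hsum]
  -- Rotate the periodic walk so that it starts at `D` if it visits `D` at all.
  by_cases hD : ∃ s, arcTail src dst (f s) = D
  · obtain ⟨s, hs⟩ := hD
    rw [← hshift s]
    refine sum_pos_of_periodic_walk src dst D res c H (fun k => f (k + s)) L hL ?_ (fun k => ?_) ?_
    · rw [add_comm, hfper, zero_add]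
    · have := hf (k + s)
      rwa [Nat.add_right_comm] at this
    · left; simpa using hs
  · push Not at hD
    exact sum_pos_of_periodic_walk src dst D res c H f L hL (by simpa using hfper 0) hf (Or.inr hD)

end DirectedArcs

/-! ### One-sided slopes of convex piecewise linear functions -/

/-- `a` and `a'` are the right and left slopes of the convex function `φ` on `[0, ∞)` at `L`, and
`φ` is affine on a one-sided neighbourhood of `L` on either side. -/
structure HasOneSidedSlopes (φ : ℝ → ℝ) (L a a' : ℝ) : Prop where
  right_eq : ∃ h > 0, ∀ s, 0 ≤ s → s ≤ h → φ (L + s) = φ L + a * s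
  left_eq : 0 < L → ∃ h > 0, ∀ s, 0 ≤ s → s ≤ h → φ (L - s) = φ L - a' * s
  slope_le : 0 < L → a' ≤ a
  right_le : ∀ y' y, L ≤ y' → y' ≤ y → a * (y - y') ≤ φ y - φ y'
  left_le : 0 < L → ∀ y y', 0 ≤ y → y ≤ y' → y' ≤ L → φ y' - φ y ≤ a' * (y' - y)

/-- Compare the chord from `L` to `y` with the affine piece near `L`; slopes of chords ending at `y`
then increase as the left endpoint moves right. -/
theorem ConvexOn.sub_le_of_right_eq {φ : ℝ → ℝ} (hc : ConvexOn ℝ (Set.Ici 0) φ) {L a h : ℝ}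
    (hL : 0 ≤ L) (hh : 0 < h) (heq : ∀ s, 0 ≤ s → s ≤ h → φ (L + s) = φ L + a * s)
    {y' y : ℝ} (h1 : L ≤ y') (h2 : y' ≤ y) : a * (y - y') ≤ φ y - φ y' := by
  have key : ∀ y, L < y → a * (y - L) ≤ φ y - φ L := by
    intro y h2
    set r := min 1 (h / (y - L)) with hr
    have hyL : 0 < y - L := sub_pos.2 h2
    have hr0 : 0 < r := lt_min one_pos (div_pos hh hyL)
    have hr1 : r ≤ 1 := min_le_left _ _
    have hrh : r * (y - L) ≤ h := (le_div_iff₀ hyL).1 (min_le_right _ _)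
    have hconv := hc.2 (show L ∈ Set.Ici 0 from hL) (show y ∈ Set.Ici 0 from hL.trans h2.le)
      (sub_nonneg.2 hr1) hr0.le (by ring)
    simp only [smul_eq_mul] at hconv
    rw [show (1 - r) * L + r * y = L + r * (y - L) by ring,
      heq _ (by positivity) hrh] at hconv
    have : r * (a * (y - L)) ≤ r * (φ y - φ L) := by linarith
    exact le_of_mul_le_mul_left this hr0
  rcases (h1.trans h2).eq_or_lt with rfl | hyL
  · rw [le_antisymm h1 h2]; simp
  have hLy := key y hyL
  have hyL : 0 < y - L := by linarith
  set r := (y' - L) / (y - L) with hr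
  have hr0 : 0 ≤ r := div_nonneg (by linarith) hyL.le
  have hr1 : r ≤ 1 := (div_le_one hyL).2 (by linarith)
  have hry : r * (y - L) = y' - L := div_mul_cancel₀ _ hyL.ne'
  have hconv := hc.2 (show L ∈ Set.Ici 0 from hL)
    (show y ∈ Set.Ici 0 from hL.trans (h1.trans h2)) (sub_nonneg.2 hr1) hr0 (by ring)
  simp only [smul_eq_mul] at hconv
  rw [show (1 - r) * L + r * y = y' by linear_combination hry] at hconv
  have h3 := mul_le_mul_of_nonneg_left hLy (sub_nonneg.2 hr1)
  have h4 : (1 - r) * (y - L) = y - y' := by linear_combination -hry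
  have h5 : (1 - r) * (a * (y - L)) = a * (y - y') := by rw [← h4]; ring
  linarith

theorem ConvexOn.sub_le_of_left_eq {φ : ℝ → ℝ} (hc : ConvexOn ℝ (Set.Ici 0) φ) {L a h : ℝ}
    (hh : 0 < h) (heq : ∀ s, 0 ≤ s → s ≤ h → φ (L - s) = φ L - a * s)
    {y y' : ℝ} (hy : 0 ≤ y) (h1 : y ≤ y') (h2 : y' ≤ L) : φ y' - φ y ≤ a * (y' - y) := by
  have key : ∀ y, 0 ≤ y → y < L → φ L - φ y ≤ a * (L - y) := by
    intro y hy h2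
    set r := min 1 (h / (L - y)) with hr
    have hyL : 0 < L - y := sub_pos.2 h2
    have hr0 : 0 < r := lt_min one_pos (div_pos hh hyL)
    have hr1 : r ≤ 1 := min_le_left _ _
    have hrh : r * (L - y) ≤ h := (le_div_iff₀ hyL).1 (min_le_right _ _)
    have hconv := hc.2 (show L ∈ Set.Ici 0 from hy.trans h2.le) (show y ∈ Set.Ici 0 from hy)
      (sub_nonneg.2 hr1) hr0.le (by ring)
    simp only [smul_eq_mul] at hconv
    rw [show (1 - r) * L + r * y = L - r * (L - y) by ring,
      heq _ (by positivity) hrh] at hconv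
    have : r * (φ L - φ y) ≤ r * (a * (L - y)) := by linarith
    exact le_of_mul_le_mul_left this hr0
  rcases (h1.trans h2).eq_or_lt with rfl | hyL
  · rw [le_antisymm h1 h2]; simp
  have hLy := key y hy hyL
  have hyL : 0 < L - y := by linarith
  set r := (L - y') / (L - y) with hr
  have hr0 : 0 ≤ r := div_nonneg (by linarith) hyL.le
  have hr1 : r ≤ 1 := (div_le_one hyL).2 (by linarith)
  have hry : r * (L - y) = L - y' := div_mul_cancel₀ _ hyL.ne'
  have hconv := hc.2 (show L ∈ Set.Ici 0 from hy.trans (h1.trans h2))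
    (show y ∈ Set.Ici 0 from hy) (sub_nonneg.2 hr1) hr0 (by ring)
  simp only [smul_eq_mul] at hconv
  rw [show (1 - r) * L + r * y = y' by linear_combination -hry] at hconv
  have h3 := mul_le_mul_of_nonneg_left hLy (sub_nonneg.2 hr1)
  have h4 : (1 - r) * (L - y) = y' - y := by linear_combination -hry
  have h5 : (1 - r) * (a * (L - y)) = a * (y' - y) := by rw [← h4]; ring
  linarith

theorem PiecewiseLinearIntegral.exists_hasOneSidedSlopes {φ : ℝ → ℝ}
    (hpl : PiecewiseLinearIntegral φ) (hc : ConvexOn ℝ (Set.Ici 0) φ) {L : ℝ} (hL : 0 ≤ L) :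
    ∃ a a', HasOneSidedSlopes φ L a a' := by
  obtain ⟨a, b, hab⟩ := hpl ⌊L⌋₊
  have hfl := Nat.floor_le hL
  have hfl' := Nat.lt_floor_add_one L
  have hr : ∀ s, 0 ≤ s → s ≤ ⌊L⌋₊ + 1 - L → φ (L + s) = φ L + a * s := fun s h0 hs => by
    rw [hab _ ⟨by linarith, by linarith⟩, hab _ ⟨hfl, hfl'.le⟩]; ring
  have hh : 0 < ⌊L⌋₊ + 1 - L := by linarith
  rcases hL.eq_or_lt with h0 | hL'
  · exact ⟨a, 0, ⟨_, hh, hr⟩, fun h => by linarith, fun h => by linarith,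
      fun _ _ h1 h2 => hc.sub_le_of_right_eq hL hh hr h1 h2, fun h => by linarith⟩
  -- The left piece lives on `[⌈L⌉₊ - 1, ⌈L⌉₊]`, which differs from the right piece exactly when `L`
  -- is an integer.
  have hce : 0 < ⌈L⌉₊ := Nat.ceil_pos.2 hL'
  obtain ⟨a', b', hab'⟩ := hpl (⌈L⌉₊ - 1)
  have hcast : ((⌈L⌉₊ - 1 : ℕ) : ℝ) = ⌈L⌉₊ - 1 := by
    rw [Nat.cast_sub (by omega)]; simp
  rw [hcast] at hab'
  have hle := Nat.le_ceil L
  have hlt := Nat.ceil_lt_add_one hL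
  have hl : ∀ s, 0 ≤ s → s ≤ L - (⌈L⌉₊ - 1) → φ (L - s) = φ L - a' * s := fun s h0 hs => by
    rw [hab' _ ⟨by linarith, by linarith⟩, hab' _ ⟨by linarith, by linarith⟩]; ring
  have hh' : 0 < L - (⌈L⌉₊ - 1) := by linarith
  refine ⟨a, a', ⟨_, hh, hr⟩, fun _ => ⟨_, hh', hl⟩, fun _ => ?_,
      fun _ _ h1 h2 => hc.sub_le_of_right_eq hL hh hr h1 h2,
      fun _ _ _ h0 h1 h2 => hc.sub_le_of_left_eq hh' hl h0 h1 h2⟩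
  -- Midpoint convexity at `L - s`, `L`, `L + s`, with both outer points on the affine pieces,
  -- orders the slopes.
  set s := min L (min (⌊L⌋₊ + 1 - L) (L - (⌈L⌉₊ - 1))) with hs
  have hs0 : 0 < s := lt_min hL' (lt_min hh hh')
  have hconv := hc.2 (show L - s ∈ Set.Ici 0 from (sub_nonneg.2 (min_le_left _ _) : 0 ≤ L - s))
    (show L + s ∈ Set.Ici 0 from by simp only [Set.mem_Ici]; linarith)
    (show (0 : ℝ) ≤ 1 / 2 by norm_num) (show (0 : ℝ) ≤ 1 / 2 by norm_num) (by norm_num)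
  simp only [smul_eq_mul] at hconv
  rw [hr s hs0.le ((min_le_right _ _).trans (min_le_left _ _)),
    hl s hs0.le ((min_le_right _ _).trans (min_le_right _ _)),
    show 1 / 2 * (L - s) + 1 / 2 * (L + s) = L by ring] at hconv
  have : s * a' ≤ s * a := by linarith
  exact le_of_mul_le_mul_left this hs0

/-! ### The split residual graph and optimality -/

namespace RoutingNetwork

variable {V : Type*} [Fintype V] [DecidableEq V] (N : RoutingNetwork V)

/-- Sources in the split graph, in which a node `i ∈ Vs` becomes an internal edge from
`some (i, false)` to `some (i, true)`, and all destinations are merged into `none`. -/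
def splitSrc : N.Edge ⊕ V → Option (V × Bool)
  | .inl e => if e.1.1 ∈ N.Vs then some (e.1.1, true) else none
  | .inr i => some (i, false)

/-- Targets in the split graph. -/
def splitDst : N.Edge ⊕ V → Option (V × Bool)
  | .inl e => if e.1.2 ∈ N.Vs then some (e.1.2, false) else none
  | .inr i => some (i, true)

/-- The arcs of the split graph along which the flow `x` may be changed. -/
def Residual (x : N.Edge → ℝ) : (N.Edge ⊕ V) × Bool → Prop
  | (.inl e, true) => x e < N.cap e
  | (.inl e, false) => 0 < x e
  | (.inr i, true) => i ∈ N.Vs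
  | (.inr i, false) => i ∈ N.Vs ∧ 0 < N.load x i

/-- The marginal costs of the arcs, given the one-sided slopes of the penalties. -/
def arcCost (κ κ' : V → ℝ) : (N.Edge ⊕ V) × Bool → ℝ
  | (.inl e, true) => (1 - N.w) * N.cost e
  | (.inl e, false) => -((1 - N.w) * N.cost e)
  | (.inr i, true) => N.w * κ i
  | (.inr i, false) => -(N.w * κ' i)

/-- `κ i` and `κ' i` are the right and left slopes of the penalty of `i` at its load under `x`. -/
def PenaltySlopes (x : N.Edge → ℝ) (κ κ' : V → ℝ) : Prop :=
  ∀ i ∈ N.Vs, HasOneSidedSlopes (N.penalty i) (N.load x i) (κ i) (κ' i)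

variable {N}

theorem Feasible.load_nonneg {x : N.Edge → ℝ} (hx : N.Feasible x) (i : V) : 0 ≤ N.load x i :=
  Finset.sum_nonneg fun e _ => (hx.2 e).1

theorem Feasible.exists_penaltySlopes {x : N.Edge → ℝ} (hx : N.Feasible x) :
    ∃ κ κ', N.PenaltySlopes x κ κ' := by
  have h : ∀ i, ∃ a a', i ∈ N.Vs → HasOneSidedSlopes (N.penalty i) (N.load x i) a a' := by
    intro i
    by_cases hi : i ∈ N.Vs
    · obtain ⟨a, a', h⟩ := (N.penalty_piecewiseLinear i hi).exists_hasOneSidedSlopes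
        (N.penalty_convex i hi) (hx.load_nonneg i)
      exact ⟨a, a', fun _ => h⟩
    · exact ⟨0, 0, fun h => (hi h).elim⟩
  choose κ κ' h using h
  exact ⟨κ, κ', fun i hi => h i hi⟩

open Finset in
theorem sum_arcs_mul_sub (g : Option (V × Bool) → ℝ) (p : (N.Edge ⊕ V) × Bool → ℝ) :
    ∑ a, p a * (g (arcHead N.splitSrc N.splitDst a) - g (arcTail N.splitSrc N.splitDst a)) =
      ∑ u, (p (u, true) - p (u, false)) * (g (N.splitDst u) - g (N.splitSrc u)) := by
  rw [Fintype.sum_prod_type]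
  refine sum_congr rfl fun u _ => ?_
  simp [arcHead, arcTail]
  ring

open Finset in
theorem sum_outEdges_of_circulation {p : (N.Edge ⊕ V) × Bool → ℝ}
    (hcirc : ∀ g : Option (V × Bool) → ℝ, ∑ a, p a *
      (g (arcHead N.splitSrc N.splitDst a) - g (arcTail N.splitSrc N.splitDst a)) = 0) {i : V} (hi : i ∈ N.Vs) :
    ∑ e ∈ N.outEdges i, (p (.inl e, true) - p (.inl e, false)) =
      p (.inr i, true) - p (.inr i, false) := by
  -- Testing the circulation against the indicator of a single vertex gives conservation at that
  -- vertex.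
  obtain ⟨g, hg⟩ : ∃ g : Option (V × Bool) → ℝ, ∀ v, g v = if v = some (i, true) then 1 else 0 :=
    ⟨_, fun _ => rfl⟩
  have h := (sum_arcs_mul_sub g p).symm.trans (hcirc g)
  rw [Fintype.sum_sum_type] at h
  have h1 : ∀ e : N.Edge, N.splitDst (.inl e) ≠ some (i, true) := by
    intro e; simp only [splitDst]; split_ifs <;> simp
  have h2 : ∀ e : N.Edge, N.splitSrc (.inl e) = some (i, true) ↔ e.1.1 = i := by
    intro e
    simp only [splitSrc]
    split_ifs with h
    · simp
    · simp only [false_iff]; rintro rfl; exact h hi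
  have h3 : ∀ j : V, N.splitSrc (.inr j) ≠ some (i, true) := by simp [splitSrc]
  have h4 : ∀ j : V, N.splitDst (.inr j) = some (i, true) ↔ j = i := by simp [splitDst]
  simp only [hg, h1, h2, h3, h4, if_false, sub_zero, zero_sub, mul_neg, mul_ite, mul_one, mul_zero,
    sum_neg_distrib, sum_ite_eq', mem_univ, if_true, ← sum_filter] at h
  rw [outEdges]
  linarith

open Finset in
theorem sum_inEdges_of_circulation {p : (N.Edge ⊕ V) × Bool → ℝ}
    (hcirc : ∀ g : Option (V × Bool) → ℝ, ∑ a, p a *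
      (g (arcHead N.splitSrc N.splitDst a) - g (arcTail N.splitSrc N.splitDst a)) = 0) {i : V} (hi : i ∈ N.Vs) :
    ∑ e ∈ N.inEdges i, (p (.inl e, true) - p (.inl e, false)) =
      p (.inr i, true) - p (.inr i, false) := by
  obtain ⟨g, hg⟩ : ∃ g : Option (V × Bool) → ℝ, ∀ v, g v = if v = some (i, false) then 1 else 0 :=
    ⟨_, fun _ => rfl⟩
  have h := (sum_arcs_mul_sub g p).symm.trans (hcirc g)
  rw [Fintype.sum_sum_type] at h
  have h1 : ∀ e : N.Edge, N.splitSrc (.inl e) ≠ some (i, false) := by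
    intro e; simp only [splitSrc]; split_ifs <;> simp
  have h2 : ∀ e : N.Edge, N.splitDst (.inl e) = some (i, false) ↔ e.1.2 = i := by
    intro e
    simp only [splitDst]
    split_ifs with h
    · simp
    · simp only [false_iff]; rintro rfl; exact h hi
  have h3 : ∀ j : V, N.splitDst (.inr j) ≠ some (i, false) := by simp [splitDst]
  have h4 : ∀ j : V, N.splitSrc (.inr j) = some (i, false) ↔ j = i := by simp [splitSrc]
  simp only [hg, h1, h2, h3, h4, if_false, sub_zero, zero_sub, mul_neg, mul_ite, mul_one, mul_zero,
    sum_neg_distrib, sum_ite_eq', mem_univ, if_true, ← sum_filter] at h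
  rw [inEdges]
  linarith

open Filter Topology in
theorem eventually_add_mul_nonneg_le {x d u : ℝ} (h0 : 0 ≤ x) (hu : x ≤ u) (hpos : 0 < d → x < u)
    (hneg : d < 0 → 0 < x) : ∀ᶠ ε in 𝓝[>] (0 : ℝ), 0 ≤ x + ε * d ∧ x + ε * d ≤ u := by
  have hcont : Tendsto (fun ε : ℝ => x + ε * d) (𝓝[>] 0) (𝓝 x) := by
    have : Continuous fun ε : ℝ => x + ε * d := by fun_prop
    simpa using (this.tendsto 0).mono_left nhdsWithin_le_nhds
  refine Filter.Eventually.and ?_ ?_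
  · by_cases hd : d < 0
    · exact (hcont.eventually (lt_mem_nhds (hneg hd))).mono fun _ => le_of_lt
    · filter_upwards [self_mem_nhdsWithin] with ε (hε : 0 < ε)
      have := mul_nonneg hε.le (not_lt.1 hd)
      linarith
  · by_cases hd : 0 < d
    · exact (hcont.eventually (gt_mem_nhds (hpos hd))).mono fun _ => le_of_lt
    · filter_upwards [self_mem_nhdsWithin] with ε (hε : 0 < ε)
      have := mul_nonneg hε.le (neg_nonneg.2 (not_lt.1 hd))
      linarith

-- An internal edge may be used in both directions, by `p` and `q`, while the load only sees `p -
-- q`. Cancelling the common part does not raise the cost, since `a' ≤ a`.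
open Filter Topology in
theorem _root_.HasOneSidedSlopes.eventually_le {φ : ℝ → ℝ} {L a a' p q : ℝ}
    (h : HasOneSidedSlopes φ L a a') (hp : 0 ≤ p) (hq : 0 ≤ q) (hqL : q ≠ 0 → 0 < L) :
    ∀ᶠ ε in 𝓝[>] (0 : ℝ), φ (L + ε * (p - q)) ≤ φ L + ε * (p * a - q * a') := by
  have hcont : ∀ r : ℝ, Tendsto (fun ε : ℝ => ε * r) (𝓝[>] 0) (𝓝 0) := fun r => by
    have : Continuous fun ε : ℝ => ε * r := by fun_prop
    simpa using (this.tendsto 0).mono_left nhdsWithin_le_nhds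
  rcases le_or_gt q p with hpq | hpq
  · obtain ⟨δ, hδ, heq⟩ := h.right_eq
    filter_upwards [self_mem_nhdsWithin, (hcont (p - q)).eventually (gt_mem_nhds hδ)]
      with ε (hε : 0 < ε) hεδ
    rw [heq _ (mul_nonneg hε.le (sub_nonneg.2 hpq)) hεδ.le]
    have : q * a' ≤ q * a := by
      by_cases hq0 : q = 0
      · simp [hq0]
      · exact mul_le_mul_of_nonneg_left (h.slope_le (hqL hq0)) hq
    nlinarith
  · have hL := hqL (hp.trans_lt hpq).ne'
    obtain ⟨δ, hδ, heq⟩ := h.left_eq hL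
    filter_upwards [self_mem_nhdsWithin, (hcont (q - p)).eventually (gt_mem_nhds hδ)]
      with ε (hε : 0 < ε) hεδ
    rw [show L + ε * (p - q) = L - ε * (q - p) by ring,
      heq _ (mul_nonneg hε.le (sub_nonneg.2 hpq.le)) hεδ.le]
    have := mul_le_mul_of_nonneg_left (h.slope_le hL) hp
    nlinarith

open Finset in
theorem sum_arcs_mul_arcCost (κ κ' : V → ℝ) (p : (N.Edge ⊕ V) × Bool → ℝ)
    (hp : ∀ i ∉ N.Vs, ∀ b, p (.inr i, b) = 0) :
    ∑ a, p a * N.arcCost κ κ' a =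
      (1 - N.w) * ∑ e, N.cost e * (p (.inl e, true) - p (.inl e, false)) +
        N.w * ∑ i ∈ N.Vs, (p (.inr i, true) * κ i - p (.inr i, false) * κ' i) := by
  rw [Fintype.sum_prod_type, Fintype.sum_sum_type, mul_sum, mul_sum]
  congr 1
  · refine sum_congr rfl fun e _ => ?_
    simp [arcCost]
    ring
  · rw [← sum_subset (subset_univ N.Vs)]
    · refine sum_congr rfl fun i _ => ?_
      simp [arcCost]
      ring
    · intro i _ hi
      simp [hp i hi]

-- Pushing a small multiple of the circulation keeps the flow feasible and raises the objective by
-- at most that multiple of its cost. Optimality excludes negative cost; at cost zero the new flow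
-- is also optimal, so uniqueness forces zero net change.
open Finset Filter Topology in
theorem circulationsPos_of_unique {x : N.Edge → ℝ} (hopt : N.IsOptimal x)
    (huniq : ∀ y : N.Edge → ℝ, N.IsOptimal y → y = x) {κ κ' : V → ℝ}
    (hκ : N.PenaltySlopes x κ κ') :
    CirculationsPos N.splitSrc N.splitDst (N.Residual x) (N.arcCost κ κ') := by
  intro p hp hres hcirc
  have hnot : ∀ i ∉ N.Vs, ∀ b, p (.inr i, b) = 0 := by
    rintro i hi (_ | _) <;> by_contra h
    · exact hi (hres _ h).1
    · exact hi (hres _ h)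
  set d : N.Edge → ℝ := fun e => p (.inl e, true) - p (.inl e, false) with hd
  have hout : ∀ i ∈ N.Vs, ∑ e ∈ N.outEdges i, d e = p (.inr i, true) - p (.inr i, false) :=
    fun i hi => sum_outEdges_of_circulation hcirc hi
  have hin : ∀ i ∈ N.Vs, ∑ e ∈ N.inEdges i, d e = p (.inr i, true) - p (.inr i, false) :=
    fun i hi => sum_inEdges_of_circulation hcirc hi
  have hcap : ∀ᶠ ε in 𝓝[>] (0 : ℝ), ∀ e, 0 ≤ x e + ε * d e ∧ x e + ε * d e ≤ N.cap e := by
    refine eventually_all.2 fun e => eventually_add_mul_nonneg_le (hopt.1.2 e).1 (hopt.1.2 e).2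
      (fun h => hres (.inl e, true) fun h0 => ?_) (fun h => hres (.inl e, false) fun h0 => ?_)
    · have := hp (.inl e, false)
      simp only [hd, h0] at h
      linarith
    · have := hp (.inl e, true)
      simp only [hd, h0] at h
      linarith
  have hpen : ∀ᶠ ε in 𝓝[>] (0 : ℝ), ∀ i ∈ N.Vs,
      N.penalty i (N.load x i + ε * (p (.inr i, true) - p (.inr i, false))) ≤
        N.penalty i (N.load x i) + ε * (p (.inr i, true) * κ i - p (.inr i, false) * κ' i) :=
    (eventually_all_finset _).2 fun i hi =>
      (hκ i hi).eventually_le (hp _) (hp _) fun h => (hres (.inr i, false) h).2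
  obtain ⟨ε, hcap, hpen, hε⟩ :=
    (hcap.and (hpen.and (self_mem_nhdsWithin (s := Set.Ioi (0 : ℝ))))).exists
  replace hε : 0 < ε := hε
  set y : N.Edge → ℝ := fun e => x e + ε * d e with hy
  have hload : ∀ i ∈ N.Vs,
      N.load y i = N.load x i + ε * (p (.inr i, true) - p (.inr i, false)) := by
    intro i hi
    rw [← hout i hi, load, load, mul_sum, ← sum_add_distrib]
  have hyf : N.Feasible y := by
    refine ⟨fun i hi => ?_, hcap⟩
    have hx := hopt.1.1 i hi
    simp only [Conserves, hy, sum_add_distrib, ← mul_sum, hout i hi, hin i hi] at hx ⊢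
    linarith
  have hobj : N.objective y ≤ N.objective x + ε * ∑ a, p a * N.arcCost κ κ' a := by
    rw [sum_arcs_mul_arcCost κ κ' p hnot, objective, objective]
    have h1 : ∑ e, N.cost e * y e = ∑ e, N.cost e * x e + ε * ∑ e, N.cost e * d e := by
      rw [mul_sum, ← sum_add_distrib]
      exact sum_congr rfl fun e _ => by simp only [hy]; ring
    have h2 : ∑ i ∈ N.Vs, N.penalty i (N.load y i) ≤ ∑ i ∈ N.Vs, N.penalty i (N.load x i) +
        ε * ∑ i ∈ N.Vs, (p (.inr i, true) * κ i - p (.inr i, false) * κ' i) := by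
      rw [mul_sum, ← sum_add_distrib]
      exact sum_le_sum fun i hi => by rw [hload i hi]; exact hpen i hi
    have h3 := mul_le_mul_of_nonneg_left h2 N.w_nonneg
    rw [h1]
    linarith
  have hmin := hopt.2 y hyf
  refine ⟨?_, fun h0 => ?_⟩
  · by_contra hneg
    have := mul_neg_of_pos_of_neg hε (not_le.1 hneg)
    linarith
  · rw [h0, mul_zero, add_zero] at hobj
    have hyx := huniq y ⟨hyf, fun z hz => hobj.trans (hopt.2 z hz)⟩
    have hd0 : ∀ e, d e = 0 := fun e => by
      have := congrFun hyx e
      simpa [hy, hε.ne'] using this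
    rintro (e | i)
    · exact sub_eq_zero.1 (hd0 e)
    · by_cases hi : i ∈ N.Vs
      -- On an internal edge the net change is the sum of the net changes on the outgoing edges.
      · exact sub_eq_zero.1 ((hout i hi).symm.trans (sum_eq_zero fun e _ => hd0 e))
      · rw [hnot i hi, hnot i hi]

end RoutingNetwork

/-! ### Truncated potentials as bounds on walk weights -/

/-- `fwd t a` bounds below the weight of walks that start at `a` and either reach `term` or continue
for `t` steps; `bwd t a` does the same for walks arriving at `a`. Both count `a`, which is why their
sum is compared with `c a`. -/
theorem exists_step_bounds {A : Type*} [Finite A] (R : A → A → Prop) (term init : A → Prop)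
    (c ρ : A → ℝ) {ε : ℝ} (hε : 0 < ε) (hρ : ∀ a b, R a b → ε + ρ b - ρ a ≤ c a)
    (hend : ∀ a b, term a → init b → ε + ρ b - ρ a ≤ c a) :
    ∃ fwd bwd : ℕ → A → ℝ,
      (∀ a, fwd 0 a ≤ c a) ∧ (∀ a, bwd 0 a ≤ c a) ∧
      (∀ t a, fwd t a ≤ fwd (t + 1) a) ∧ (∀ t a, bwd t a ≤ bwd (t + 1) a) ∧
      (∀ t a, term a → fwd t a ≤ c a) ∧ (∀ t a, init a → bwd t a ≤ c a) ∧
      (∀ t a b, R a b → fwd (t + 1) a ≤ c a + fwd t b) ∧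
      (∀ t a b, R a b → bwd (t + 1) b ≤ c b + bwd t a) ∧
      ∃ T : ℕ, ∀ t, T ≤ t → ∀ a, c a < fwd t a + bwd t a := by
  -- The level `β` separates initial from terminal arcs with a gap of `ε`, which is what `hend`
  -- allows.
  obtain ⟨β, hβi, hβt⟩ : ∃ β, (∀ b, init b → ρ b ≤ β) ∧ ∀ a, term a → β + ε ≤ c a + ρ a := by
    by_cases h : ∃ b, init b
    · obtain ⟨b, hb, hmax⟩ := Set.exists_max_image {b | init b} ρ (Set.toFinite _) h
      exact ⟨ρ b, hmax, fun a ha => by linarith [hend a b ha hb]⟩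
    · obtain ⟨β, hβ⟩ := (Set.finite_range fun a => c a + ρ a - ε).bddBelow
      refine ⟨β, fun b hb => (h ⟨b, hb⟩).elim, fun a _ => ?_⟩
      have : β ≤ c a + ρ a - ε := hβ ⟨a, rfl⟩
      linarith
  obtain ⟨C, hC1, hC2⟩ : ∃ C, (∀ a, -ρ a - c a ≤ C) ∧ ∀ a, ρ a ≤ C := by
    obtain ⟨C1, h1⟩ := (Set.finite_range fun a => -ρ a - c a).bddAbove
    obtain ⟨C2, h2⟩ := (Set.finite_range ρ).bddAbove
    exact ⟨max C1 C2, fun a => (h1 ⟨a, rfl⟩).trans (le_max_left _ _),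
      fun a => (h2 ⟨a, rfl⟩).trans (le_max_right _ _)⟩
  have hstep : ∀ (M : ℝ) (t : ℕ), min (ε * (t + 1 : ℕ) - C) M ≤ ε + min (ε * t - C) M := by
    intro M t
    rw [← min_add_add_left]
    push_cast
    exact min_le_min (by linarith) (by linarith)
  have hmono : ∀ (M : ℝ) (t : ℕ), min (ε * t - C) M ≤ min (ε * (t + 1 : ℕ) - C) M := by
    intro M t
    push_cast
    exact min_le_min (by linarith) le_rfl
  -- The slack accumulates linearly from `-C`, low enough for time zero, and is capped so that the
  -- bounds at terminal and initial arcs persist. The caps `β + ε` and `-β` add up to `ε > 0`.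
  refine ⟨fun t a => -ρ a + min (ε * t - C) (β + ε), fun t a => c a + ρ a + min (ε * t - C) (-β),
    fun a => ?_, fun a => ?_, fun t a => ?_, fun t a => ?_, fun t a ha => ?_, fun t a ha => ?_,
    fun t a b hab => ?_, fun t a b hab => ?_, ?_⟩
  · have := min_le_left (ε * (0 : ℕ) - C) (β + ε)
    have := hC1 a
    simp only [Nat.cast_zero, mul_zero] at *
    linarith
  · have := min_le_left (ε * (0 : ℕ) - C) (-β)
    have := hC2 a
    simp only [Nat.cast_zero, mul_zero] at *
    linarith
  · linarith [hmono (β + ε) t]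
  · linarith [hmono (-β) t]
  · linarith [min_le_right (ε * (t : ℝ) - C) (β + ε), hβt a ha]
  · linarith [min_le_right (ε * (t : ℝ) - C) (-β), hβi a ha]
  · linarith [hstep (β + ε) t, hρ a b hab]
  · linarith [hstep (-β) t, hρ a b hab]
  · obtain ⟨T, hT⟩ := exists_nat_gt ((C + |β| + ε) / ε)
    refine ⟨T, fun t ht a => ?_⟩
    have h1 : C + |β| + ε < ε * t := by
      rw [div_lt_iff₀ hε] at hT
      have : (T : ℝ) ≤ t := by exact_mod_cast ht
      nlinarith
    have h2 := le_abs_self β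
    have h3 := neg_abs_le β
    have h4 : -β < ε * t - C := by linarith
    have h5 : 0 < min (ε * t - C) (β + ε) + -β := by
      rcases min_choice (ε * t - C) (β + ε) with h | h <;> rw [h] <;> linarith
    beta_reduce
    rw [min_eq_right h4.le]
    linarith

/-! ### Conformal rerouting at a node -/

open Finset in
theorem exists_portion {E : Type*} (J : Finset E) (κ : E → ℝ) (hκ : ∀ e, 0 ≤ κ e) {θ : ℝ}
    (h0 : 0 ≤ θ) (h1 : θ ≤ ∑ e ∈ J, κ e) :
    ∃ τ : E → ℝ, (∀ e, 0 ≤ τ e ∧ τ e ≤ κ e) ∧ ∑ e ∈ J, τ e = θ := by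
  have hs : 0 ≤ ∑ e ∈ J, κ e := h0.trans h1
  refine ⟨fun e => κ e * (θ / ∑ e ∈ J, κ e), fun e => ⟨mul_nonneg (hκ e) (div_nonneg h0 hs),
    mul_le_of_le_one_right (hκ e) (div_le_one_of_le₀ h1 hs)⟩, ?_⟩
  rw [← sum_mul]
  rcases hs.eq_or_lt with h | h
  · rw [← h] at h1 ⊢
    linarith
  · field_simp

open Finset in
/-- An excess `θ` entering a node through the edge `e` on the side `S` is absorbed by the deficits
on the same side and the excesses on the opposite side. -/
theorem exists_conformal_rerouting {E : Type*} [DecidableEq E] (S O : Finset E)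
    {e : E} (he : e ∈ S) (d : E → ℝ) (hd : ∑ x ∈ S, d x = ∑ x ∈ O, d x) {θ : ℝ} (h0 : 0 ≤ θ)
    (h1 : θ ≤ d e) :
    ∃ σ τ : E → ℝ, (∀ x, 0 ≤ σ x ∧ (0 < σ x → σ x ≤ -d x)) ∧
      (∀ x, 0 ≤ τ x ∧ (0 < τ x → τ x ≤ d x)) ∧
      ∑ x ∈ S.erase e, σ x + ∑ x ∈ O, τ x = θ ∧
      (0 < ∑ x ∈ O, τ x → ∑ x ∈ O, τ x ≤ ∑ x ∈ O, d x) := by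
  have hO : ∑ x ∈ O, d x ≤ ∑ x ∈ O, max 0 (d x) := sum_le_sum fun _ _ => le_max_right _ _
  have hO0 : 0 ≤ ∑ x ∈ O, max 0 (d x) := sum_nonneg fun _ _ => le_max_left _ _
  have hS0 : 0 ≤ ∑ x ∈ S.erase e, max 0 (-d x) := sum_nonneg fun _ _ => le_max_left _ _
  have hS : -∑ x ∈ S.erase e, d x ≤ ∑ x ∈ S.erase e, max 0 (-d x) := by
    rw [← sum_neg_distrib]
    exact sum_le_sum fun _ _ => le_max_right _ _
  have hsplit := add_sum_erase S d he
  -- As much as possible crosses to the opposite side, but never more than the excess load, so that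
  -- the load does not move past its reference value. The rest fits into the deficits on the same
  -- side.
  have hl0 : 0 ≤ min θ (max 0 (∑ x ∈ O, d x)) := le_min h0 (le_max_left _ _)
  obtain ⟨τ, hτ, hτs⟩ := exists_portion O (fun x => max 0 (d x)) (fun _ => le_max_left _ _) hl0
    ((min_le_right _ _).trans (max_le hO0 hO))
  obtain ⟨σ, hσ, hσs⟩ := exists_portion (S.erase e) (fun x => max 0 (-d x))
    (fun _ => le_max_left _ _) (sub_nonneg.2 (min_le_left θ (max 0 (∑ x ∈ O, d x)))) (by
      rcases min_choice θ (max 0 (∑ x ∈ O, d x)) with h | h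
      · rw [h, sub_self]; exact hS0
      · rw [h]
        linarith [le_max_right 0 (∑ x ∈ O, d x)])
  have hmax : ∀ {a b : ℝ}, a ≤ max 0 b → 0 < a → a ≤ b := fun {a b} h ha =>
    (le_max_iff.1 h).resolve_left (not_le.2 ha)
  refine ⟨σ, τ, fun x => ⟨(hσ x).1, hmax (hσ x).2⟩, fun x => ⟨(hτ x).1, hmax (hτ x).2⟩, ?_, ?_⟩
  · rw [hτs, hσs]; ring
  · rw [hτs]
    exact hmax (min_le_right _ _)

/-! ### Finiteness of messages in the extended reals -/

open Finset in
theorem EReal.coe_sum_real {ι : Type*} (s : Finset ι) (f : ι → ℝ) :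
    ((∑ i ∈ s, f i : ℝ) : EReal) = ∑ i ∈ s, (f i : EReal) := by
  classical
  induction s using Finset.induction_on with
  | empty => simp
  | insert a s ha ih => rw [sum_insert ha, sum_insert ha, EReal.coe_add, ih]

open Finset in
theorem EReal.sum_ne_bot {ι : Type*} (s : Finset ι) (f : ι → EReal) (hf : ∀ i, f i ≠ ⊥) :
    ∑ i ∈ s, f i ≠ ⊥ := by
  classical
  induction s using Finset.induction_on with
  | empty => simp
  | insert a s ha ih => rw [sum_insert ha]; exact EReal.add_ne_bot_iff.2 ⟨hf a, ih⟩

open Finset in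
theorem EReal.sum_eq_top {ι : Type*} [DecidableEq ι] (s : Finset ι) (f : ι → EReal)
    (hf : ∀ i, f i ≠ ⊥) {i : ι} (hi : i ∈ s) (htop : f i = ⊤) : ∑ i ∈ s, f i = ⊤ := by
  rw [← add_sum_erase s f hi, htop, EReal.top_add_of_ne_bot (EReal.sum_ne_bot _ _ hf)]

namespace RoutingNetwork

variable {V : Type*} [Fintype V] [DecidableEq V] (N : RoutingNetwork V)

/-- The edges entering (`true`) or leaving (`false`) the node `i`. -/
def sideEdges (i : V) (b : Bool) : Finset N.Edge := if b then N.inEdges i else N.outEdges i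

/-- The part of the message update that is minimized. -/
noncomputable def updateCost (t : ℕ) (i : V) (e : N.Edge) (y : N.Edge → ℝ) : EReal :=
  N.nodeFun i y + ∑ e' ∈ (N.incEdges i).erase e, N.message t (N.otherEnd i e') e' (y e')

/-- The minimum in the message update. -/
noncomputable def updateInf (t : ℕ) (i : V) (e : N.Edge) (z : ℝ) : EReal :=
  ⨅ (y : N.Edge → ℝ) (_ : (∀ e', 0 ≤ y e') ∧ y e = z), N.updateCost t i e y

variable {N}

theorem mem_inEdges {i : V} {e : N.Edge} : e ∈ N.inEdges i ↔ e.1.2 = i := by simp [inEdges]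

theorem mem_outEdges {i : V} {e : N.Edge} : e ∈ N.outEdges i ↔ e.1.1 = i := by simp [outEdges]

theorem fst_ne_snd (e : N.Edge) : e.1.1 ≠ e.1.2 := N.loopless _ e.2

theorem disjoint_sideEdges (i : V) (b : Bool) :
    Disjoint (N.sideEdges i b) (N.sideEdges i (!b)) := by
  rw [Finset.disjoint_left]
  intro e
  have := fst_ne_snd e
  cases b <;> simp [sideEdges, mem_inEdges, mem_outEdges] <;> rintro rfl
  · exact this.symm
  · exact this

theorem incEdges_eq_sideEdges_union (i : V) (b : Bool) :
    N.incEdges i = N.sideEdges i b ∪ N.sideEdges i (!b) := by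
  cases b
  · simp [sideEdges, incEdges]
  · simp [sideEdges, incEdges, Finset.union_comm]

theorem erase_incEdges (i : V) (b : Bool) {e : N.Edge} (he : e ∈ N.sideEdges i b) :
    (N.incEdges i).erase e = (N.sideEdges i b).erase e ∪ N.sideEdges i (!b) := by
  rw [incEdges_eq_sideEdges_union i b, Finset.erase_union_distrib,
    Finset.erase_eq_of_notMem (Finset.disjoint_left.1 (disjoint_sideEdges i b) he)]

theorem message_zero (i : V) (e : N.Edge) (z : ℝ) : N.message 0 i e z = N.edgeFun e z := rfl

theorem message_succ_of_mem (t : ℕ) {i : V} (hi : i ∈ N.Vs) (e : N.Edge) (z : ℝ) :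
    N.message (t + 1) i e z = N.edgeFun e z + N.updateInf t i e z := by
  rw [message, if_pos hi]
  rfl

theorem message_of_notMem (t : ℕ) {i : V} (hi : i ∉ N.Vs) (e : N.Edge) (z : ℝ) :
    N.message t i e z = N.edgeFun e z := by
  induction t with
  | zero => rfl
  | succ t ih => rw [message, if_neg hi, ih]

theorem edgeFun_of_mem {e : N.Edge} {z : ℝ} (h : 0 ≤ z ∧ z ≤ N.cap e) :
    N.edgeFun e z = (((1 - N.w) * N.cost e * z : ℝ) : EReal) := if_pos h

theorem edgeFun_of_notMem {e : N.Edge} {z : ℝ} (h : ¬ (0 ≤ z ∧ z ≤ N.cap e)) :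
    N.edgeFun e z = ⊤ := if_neg h

theorem edgeFun_nonneg (e : N.Edge) (z : ℝ) : 0 ≤ N.edgeFun e z := by
  by_cases h : 0 ≤ z ∧ z ≤ N.cap e
  · rw [edgeFun_of_mem h]
    exact_mod_cast mul_nonneg (mul_nonneg (sub_nonneg.2 N.w_le_one) (N.cost_pos e).le) h.1
  · rw [edgeFun_of_notMem h]
    exact le_top

theorem nodeFun_of_conserves {i : V} (hi : i ∈ N.Vs) {y : N.Edge → ℝ} (h : N.Conserves y i) :
    N.nodeFun i y = ((N.w * N.penalty i (N.load y i) : ℝ) : EReal) := by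
  rw [nodeFun, if_pos hi, if_pos h, zero_add]

theorem nodeFun_of_not_conserves {i : V} (hi : i ∈ N.Vs) {y : N.Edge → ℝ}
    (h : ¬ N.Conserves y i) : N.nodeFun i y = ⊤ := by
  rw [nodeFun, if_pos hi, if_neg h, EReal.top_add_of_ne_bot (EReal.coe_ne_bot _)]

theorem le_nodeFun {i : V} (hi : i ∈ N.Vs) {y : N.Edge → ℝ} (hy : ∀ e, 0 ≤ y e) :
    ((N.w * N.penalty i 0 : ℝ) : EReal) ≤ N.nodeFun i y := by
  by_cases h : N.Conserves y i
  · rw [nodeFun_of_conserves hi h]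
    have hload : 0 ≤ N.load y i := Finset.sum_nonneg fun e _ => hy e
    exact_mod_cast mul_le_mul_of_nonneg_left ((N.penalty_strictMono i hi).monotoneOn
      (Set.mem_Ici.2 le_rfl) (Set.mem_Ici.2 hload) hload) N.w_nonneg
  · rw [nodeFun_of_not_conserves hi h]
    exact le_top

theorem exists_le_updateInf_of_exists_le_message {t : ℕ}
    (h : ∀ i e, ∃ B : ℝ, ∀ z, (B : EReal) ≤ N.message t i e z) {i : V} (hi : i ∈ N.Vs)
    (e : N.Edge) : ∃ B : ℝ, ∀ z, (B : EReal) ≤ N.updateInf t i e z := by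
  choose B hB using h
  refine ⟨N.w * N.penalty i 0 + ∑ e' ∈ (N.incEdges i).erase e, B (N.otherEnd i e') e', fun z => ?_⟩
  refine le_iInf₂ fun y hy => ?_
  rw [EReal.coe_add, EReal.coe_sum_real]
  exact add_le_add (le_nodeFun hi hy.1) (Finset.sum_le_sum fun e' _ => hB _ _ _)

/-- A uniform real lower bound keeps the infima away from `⊥`, so that `⊤` absorbs in every sum. It
comes from nonnegative edge costs and monotone penalties. -/
theorem exists_le_message (t : ℕ) (i : V) (e : N.Edge) :
    ∃ B : ℝ, ∀ z, (B : EReal) ≤ N.message t i e z := by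
  induction t generalizing i e with
  | zero => exact ⟨0, fun z => edgeFun_nonneg e z⟩
  | succ t ih =>
    by_cases hi : i ∈ N.Vs
    · obtain ⟨B, hB⟩ := exists_le_updateInf_of_exists_le_message ih hi e
      refine ⟨B, fun z => ?_⟩
      rw [message_succ_of_mem t hi, ← zero_add (B : EReal)]
      exact add_le_add (edgeFun_nonneg e z) (hB z)
    · refine ⟨0, fun z => ?_⟩
      rw [message_of_notMem _ hi]
      exact edgeFun_nonneg e z

theorem message_ne_bot (t : ℕ) (i : V) (e : N.Edge) (z : ℝ) : N.message t i e z ≠ ⊥ := by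
  obtain ⟨B, hB⟩ := exists_le_message t i e
  exact ne_bot_of_le_ne_bot (EReal.coe_ne_bot B) (hB z)

theorem updateInf_ne_bot (t : ℕ) {i : V} (hi : i ∈ N.Vs) (e : N.Edge) (z : ℝ) :
    N.updateInf t i e z ≠ ⊥ := by
  obtain ⟨B, hB⟩ := exists_le_updateInf_of_exists_le_message (exists_le_message t) hi e
  exact ne_bot_of_le_ne_bot (EReal.coe_ne_bot B) (hB z)

theorem message_eq_top (t : ℕ) (i : V) {e : N.Edge} {z : ℝ} (h : ¬ (0 ≤ z ∧ z ≤ N.cap e)) :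
    N.message t i e z = ⊤ := by
  by_cases hi : i ∈ N.Vs
  · cases t with
    | zero => exact edgeFun_of_notMem h
    | succ t =>
      rw [message_succ_of_mem t hi, edgeFun_of_notMem h,
        EReal.top_add_of_ne_bot (updateInf_ne_bot t hi e z)]
  · rw [message_of_notMem t hi, edgeFun_of_notMem h]

/-- The feasible flow itself is a candidate in every update. -/
theorem Feasible.message_ne_top {x : N.Edge → ℝ} (hx : N.Feasible x) (t : ℕ) (i : V)
    (e : N.Edge) : N.message t i e (x e) ≠ ⊤ := by
  induction t generalizing i e with
  | zero =>
    rw [message_zero, edgeFun_of_mem (hx.2 e)]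
    exact EReal.coe_ne_top _
  | succ t ih =>
    by_cases hi : i ∈ N.Vs
    · rw [message_succ_of_mem t hi, edgeFun_of_mem (hx.2 e)]
      refine EReal.add_ne_top (EReal.coe_ne_top _) (ne_top_of_le_ne_top ?_
        (iInf₂_le x ⟨fun e' => (hx.2 e').1, rfl⟩))
      rw [updateCost, nodeFun_of_conserves hi (hx.1 i hi)]
      refine EReal.add_ne_top (EReal.coe_ne_top _) ?_
      have : ∀ s : Finset N.Edge, ∑ e' ∈ s, N.message t (N.otherEnd i e') e' (x e') ≠ ⊤ := by
        intro s
        induction s using Finset.induction_on with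
        | empty => simp
        | insert a s ha ihs =>
          rw [Finset.sum_insert ha]
          exact EReal.add_ne_top (ih _ _) ihs
      exact this _
    · rw [message_of_notMem _ hi, edgeFun_of_mem (hx.2 e)]
      exact EReal.coe_ne_top _

theorem updateCost_eq_top_of_not_conserves (t : ℕ) {i : V} (hi : i ∈ N.Vs) (e : N.Edge)
    {y : N.Edge → ℝ} (h : ¬ N.Conserves y i) : N.updateCost t i e y = ⊤ := by
  rw [updateCost, nodeFun_of_not_conserves hi h,
    EReal.top_add_of_ne_bot (EReal.sum_ne_bot _ _ fun e' => message_ne_bot _ _ _ _)]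

theorem updateCost_eq_top_of_exceeds (t : ℕ) {i : V} (hi : i ∈ N.Vs) (e : N.Edge)
    {y : N.Edge → ℝ} (hy : ∀ e, 0 ≤ y e) {e' : N.Edge} (he' : e' ∈ (N.incEdges i).erase e)
    (h : ¬ (0 ≤ y e' ∧ y e' ≤ N.cap e')) : N.updateCost t i e y = ⊤ := by
  rw [updateCost, EReal.sum_eq_top _ (fun e' => N.message t (N.otherEnd i e') e' (y e'))
    (fun e' => message_ne_bot _ _ _ _) he' (message_eq_top _ _ h), EReal.add_top_of_ne_bot]
  exact ne_bot_of_le_ne_bot (EReal.coe_ne_bot _) (le_nodeFun hi hy)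

end RoutingNetwork

/-! ### Growth rates of messages -/

/-- The sign of a direction. -/
def dirSign (η : Bool) : ℝ := if η then 1 else -1

theorem dirSign_mul_self (η : Bool) : dirSign η * dirSign η = 1 := by
  cases η <;> simp [dirSign]

theorem dirSign_not (η : Bool) : dirSign (!η) = -dirSign η := by
  cases η <;> simp [dirSign]

/-- Moving `y` back towards `x` by `θ` stays between the two. -/
theorem sub_dirSign_mul_mem {η : Bool} {x y θ u : ℝ} (hθ : 0 ≤ θ) (h : θ ≤ dirSign η * (y - x))
    (hx : 0 ≤ x ∧ x ≤ u) (hy : 0 ≤ y ∧ y ≤ u) :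
    0 ≤ y - dirSign η * θ ∧ y - dirSign η * θ ≤ u := by
  cases η <;> simp only [dirSign, if_true, Bool.false_eq_true, if_false] at h ⊢ <;>
    constructor <;> linarith [hx.1, hx.2, hy.1, hy.2]

namespace RoutingNetwork

variable {V : Type*} [Fintype V] [DecidableEq V] {N : RoutingNetwork V}

/-- `Δ t i e η` bounds from below the rate at which the message `m_{i → e}^t` grows when the flow on
`e` moves away from `x e` in the direction `η`: one step of the recursion for such bounds. -/
structure IsSlopeBound (N : RoutingNetwork V) (x : N.Edge → ℝ) (κ κ' : V → ℝ)
    (Δ : ℕ → V → N.Edge → Bool → ℝ) : Prop where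
  zero : ∀ i e η, Δ 0 i e η ≤ N.arcCost κ κ' (.inl e, η)
  destination : ∀ t i e η b, i ∉ N.Vs → e ∈ N.sideEdges i b → N.Residual x (.inl e, η) →
    Δ t i e η ≤ N.arcCost κ κ' (.inl e, η)
  same_side : ∀ t i e e' η b, i ∈ N.Vs → e ∈ N.sideEdges i b → e' ∈ N.sideEdges i b → e' ≠ e →
    N.Residual x (.inl e, η) → N.Residual x (.inl e', !η) →
    Δ (t + 1) i e η ≤ N.arcCost κ κ' (.inl e, η) + Δ t (N.otherEnd i e') e' (!η)
  opposite_side : ∀ t i e e' η b, i ∈ N.Vs → e ∈ N.sideEdges i b → e' ∈ N.sideEdges i (!b) →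
    N.Residual x (.inl e, η) → N.Residual x (.inl e', η) → N.Residual x (.inr i, η) →
    Δ (t + 1) i e η ≤
      N.arcCost κ κ' (.inl e, η) + N.arcCost κ κ' (.inr i, η) + Δ t (N.otherEnd i e') e' η

theorem arcCost_inl (κ κ' : V → ℝ) (e : N.Edge) (η : Bool) :
    N.arcCost κ κ' (.inl e, η) = dirSign η * ((1 - N.w) * N.cost e) := by
  cases η <;> simp [arcCost, dirSign]

theorem residual_inl_of_lt {x : N.Edge → ℝ} {e : N.Edge} {η : Bool} {z : ℝ}
    (hz : 0 ≤ z ∧ z ≤ N.cap e) (h : 0 < dirSign η * (z - x e)) : N.Residual x (.inl e, η) := by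
  cases η <;> simp only [dirSign, if_true, Bool.false_eq_true, if_false] at h
  · exact show 0 < x e by linarith [hz.1]
  · exact show x e < N.cap e by linarith [hz.2]

theorem residual_inr_of_lt {x y : N.Edge → ℝ} (hy : ∀ e, 0 ≤ y e) {i : V} (hi : i ∈ N.Vs)
    {η : Bool} (h : 0 < dirSign η * (N.load y i - N.load x i)) : N.Residual x (.inr i, η) := by
  have hload : 0 ≤ N.load y i := Finset.sum_nonneg fun e _ => hy e
  cases η <;> simp only [dirSign, if_true, Bool.false_eq_true, if_false] at h
  · exact ⟨hi, by linarith⟩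
  · exact hi

theorem PenaltySlopes.mul_penalty_le {x y : N.Edge → ℝ} {κ κ' : V → ℝ}
    (hκ : N.PenaltySlopes x κ κ') (hy : ∀ e, 0 ≤ y e) {i : V} (hi : i ∈ N.Vs) {η : Bool} {l : ℝ}
    (hl0 : 0 ≤ l) (hl : 0 < l → l ≤ dirSign η * (N.load y i - N.load x i)) :
    N.w * N.penalty i (N.load y i - dirSign η * l) + N.arcCost κ κ' (.inr i, η) * l ≤
      N.w * N.penalty i (N.load y i) := by
  rcases hl0.eq_or_lt with rfl | hl'
  · simp
  have hload : 0 ≤ N.load y i := Finset.sum_nonneg fun e _ => hy e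
  specialize hl hl'
  cases η <;> simp only [dirSign, if_true, Bool.false_eq_true, if_false, arcCost] at hl ⊢
  · have := (hκ i hi).left_le (by linarith) (N.load y i) (N.load y i - -1 * l) hload
      (by linarith) (by linarith)
    have := mul_le_mul_of_nonneg_left this N.w_nonneg
    linarith
  · have := (hκ i hi).right_le (N.load y i - 1 * l) (N.load y i) (by linarith) (by linarith)
    have := mul_le_mul_of_nonneg_left this N.w_nonneg
    linarith

theorem sum_sideEdges_sub_eq {x y : N.Edge → ℝ} {i : V} (hx : N.Conserves x i)
    (hy : N.Conserves y i) (b : Bool) :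
    ∑ e ∈ N.sideEdges i b, (y e - x e) = N.load y i - N.load x i := by
  unfold Conserves at hx hy
  cases b <;> simp only [sideEdges, if_true, Bool.false_eq_true, if_false,
    Finset.sum_sub_distrib, load]
  linarith

theorem conserves_and_load_of_sum_sideEdges {y y' : N.Edge → ℝ} {i : V} {r : ℝ}
    (hy : N.Conserves y i) (h : ∀ b, ∑ e ∈ N.sideEdges i b, (y e - y' e) = r) :
    N.Conserves y' i ∧ N.load y' i = N.load y i - r := by
  have h1 := h true
  have h2 := h false
  simp only [sideEdges, if_true, Bool.false_eq_true, if_false, Finset.sum_sub_distrib] at h1 h2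
  unfold Conserves load at *
  constructor <;> linarith

/-- Flow `θ` in the direction `η` on `e` is rerouted at the node `i`. -/
theorem exists_updateCost_add_le {x : N.Edge → ℝ} (hx : N.Feasible x) {κ κ' : V → ℝ}
    (hκ : N.PenaltySlopes x κ κ') {Δ : ℕ → V → N.Edge → Bool → ℝ}
    (hΔ : N.IsSlopeBound x κ κ' Δ) (t : ℕ)
    (ih : ∀ i e η, ∀ θ z : ℝ, (∃ b, e ∈ N.sideEdges i b) → 0 ≤ θ →
      θ ≤ dirSign η * (z - x e) →
      N.message t i e (z - dirSign η * θ) + ((Δ t i e η * θ : ℝ) : EReal) ≤ N.message t i e z)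
    {i : V} (hi : i ∈ N.Vs) {b : Bool} {e : N.Edge} (he : e ∈ N.sideEdges i b) {η : Bool}
    (hres : N.Residual x (.inl e, η)) {θ : ℝ} (hθ : 0 ≤ θ) {y : N.Edge → ℝ}
    (hy : ∀ e, 0 ≤ y e) (hye : y e ≤ N.cap e) (hcons : N.Conserves y i)
    (hcap : ∀ e' ∈ (N.incEdges i).erase e, y e' ≤ N.cap e')
    (h : θ ≤ dirSign η * (y e - x e)) :
    ∃ y' : N.Edge → ℝ, (∀ e', 0 ≤ y' e') ∧ y' e = y e - dirSign η * θ ∧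
      N.updateCost t i e y' +
        (((Δ (t + 1) i e η - N.arcCost κ κ' (.inl e, η)) * θ : ℝ) : EReal) ≤
        N.updateCost t i e y := by
  classical
  set S := N.sideEdges i b with hS
  set O := N.sideEdges i (!b) with hO
  have hSO : Disjoint S O := disjoint_sideEdges i b
  have hsum : ∀ b', ∑ e' ∈ N.sideEdges i b', dirSign η * (y e' - x e') =
      dirSign η * (N.load y i - N.load x i) := fun b' => by
    rw [← Finset.mul_sum, sum_sideEdges_sub_eq (hx.1 i hi) hcons]
  obtain ⟨σ, τ, hσ, hτ, hθsum, hτload⟩ := exists_conformal_rerouting S O he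
    (fun e' => dirSign η * (y e' - x e')) ((hsum b).trans (hsum (!b)).symm) hθ h
  rw [hsum] at hτload
  set l := ∑ e' ∈ O, τ e' with hl
  have hl0 : 0 ≤ l := Finset.sum_nonneg fun e' _ => (hτ e').1
  have hinc : (N.incEdges i).erase e = S.erase e ∪ O := erase_incEdges i b he
  have hSO' : Disjoint (S.erase e) O := hSO.mono_left (Finset.erase_subset _ _)
  have hSnot : ∀ e' ∈ S.erase e, e' ≠ e ∧ e' ∈ S := fun e' h => Finset.mem_erase.1 h
  have hOnot : ∀ e' ∈ O, e' ≠ e ∧ e' ∉ S := fun e' h =>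
    ⟨fun h' => Finset.disjoint_left.1 hSO he (h' ▸ h), Finset.disjoint_right.1 hSO h⟩
  -- `D` is the amount withdrawn from `y` in direction `η`. It has the same sum `l` over both sides,
  -- so conservation survives and the load moves by `l`.
  set D : N.Edge → ℝ := fun e' =>
    if e' = e then θ else if e' ∈ S then -σ e' else if e' ∈ O then τ e' else 0 with hD
  have hDe : D e = θ := by simp [hD]
  have hDS : ∀ e' ∈ S.erase e, D e' = -σ e' := fun e' h => by
    simp [hD, (hSnot e' h).1, (hSnot e' h).2]
  have hDO : ∀ e' ∈ O, D e' = τ e' := fun e' h => by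
    simp [hD, (hOnot e' h).1, (hOnot e' h).2, h]
  set y' : N.Edge → ℝ := fun e' => y e' - dirSign η * D e' with hy'
  have hDsumO : ∑ e' ∈ O, D e' = l := Finset.sum_congr rfl hDO
  have hDsumS : ∑ e' ∈ S, D e' = l := by
    rw [← Finset.add_sum_erase S D he, hDe, Finset.sum_congr rfl hDS, Finset.sum_neg_distrib]
    linarith
  have hDsum : ∀ b', ∑ e' ∈ N.sideEdges i b', (y e' - y' e') = dirSign η * l := by
    intro b'
    simp only [hy', sub_sub_cancel, ← Finset.mul_sum]
    rcases Bool.eq_or_eq_not b' b with rfl | rfl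
    · rw [← hS, hDsumS]
    · rw [← hO, hDsumO]
  obtain ⟨hcons', hload'⟩ := conserves_and_load_of_sum_sideEdges hcons hDsum
  have hy'S : ∀ e' ∈ S.erase e, y' e' = y e' - dirSign (!η) * σ e' := fun e' h => by
    simp only [hy']; rw [hDS e' h, dirSign_not]; ring
  have hy'O : ∀ e' ∈ O, y' e' = y e' - dirSign η * τ e' := fun e' h => by
    simp only [hy']; rw [hDO e' h]
  have hσ' : ∀ e', 0 < σ e' → σ e' ≤ dirSign (!η) * (y e' - x e') := fun e' h => by
    rw [dirSign_not]; linarith [(hσ e').2 h]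
  have hcap' : ∀ e' ∈ S.erase e ∪ O, 0 ≤ y e' ∧ y e' ≤ N.cap e' := fun e' h =>
    ⟨hy e', hcap e' (hinc ▸ h)⟩
  refine ⟨y', fun e' => ?_, by simp only [hy', hDe], ?_⟩
  · by_cases h1 : e' = e
    · subst h1
      simp only [hy', hDe]
      exact (sub_dirSign_mul_mem hθ h (hx.2 e') ⟨hy e', hye⟩).1
    by_cases h2 : e' ∈ S
    · have h3 := Finset.mem_erase.2 ⟨h1, h2⟩
      rw [hy'S e' h3]
      rcases (hσ e').1.eq_or_lt with h4 | h4
      · rw [← h4]; simpa using hy e'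
      · exact (sub_dirSign_mul_mem h4.le (hσ' e' h4) (hx.2 e')
          (hcap' e' (Finset.mem_union_left _ h3))).1
    by_cases h3 : e' ∈ O
    · rw [hy'O e' h3]
      rcases (hτ e').1.eq_or_lt with h4 | h4
      · rw [← h4]; simpa using hy e'
      · exact (sub_dirSign_mul_mem h4.le ((hτ e').2 h4) (hx.2 e')
          (hcap' e' (Finset.mem_union_right _ h3))).1
    · simpa [hy', hD, h1, h2, h3] using hy e'
  -- The gain `K * θ` is distributed over the rerouted units: each unit on the same side accounts
  -- for `K`, each unit crossing the node for `K - ν`, the missing `ν` being paid by the penalty.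
  set K := Δ (t + 1) i e η - N.arcCost κ κ' (.inl e, η) with hK
  set ν := N.arcCost κ κ' (.inr i, η) with hν
  set q : N.Edge → ℝ := fun e' => if e' ∈ O then (K - ν) * τ e' else K * σ e' with hq
  have hmsg : ∀ e' ∈ S.erase e ∪ O,
      N.message t (N.otherEnd i e') e' (y' e') + (q e' : EReal) ≤
        N.message t (N.otherEnd i e') e' (y e') := by
    intro e' he'
    have hother : ∃ b', e' ∈ N.sideEdges (N.otherEnd i e') b' := by
      unfold otherEnd
      split_ifs with h
      · exact ⟨true, by simp [sideEdges, mem_inEdges]⟩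
      · exact ⟨false, by simp [sideEdges, mem_outEdges]⟩
    rcases Finset.mem_union.1 he' with h1 | h1
    · have h2 : e' ∉ O := Finset.disjoint_left.1 hSO' h1
      rw [hy'S e' h1]
      simp only [hq, if_neg h2]
      rcases (hσ e').1.eq_or_lt with h3 | h3
      · rw [← h3]; simp
      · refine le_trans (add_le_add_right ?_ _) (ih _ e' (!η) (σ e') (y e') hother h3.le (hσ' e' h3))
        refine EReal.coe_le_coe_iff.2 (mul_le_mul_of_nonneg_right ?_ h3.le)
        have := hΔ.same_side t i e e' η b hi he (hSnot e' h1).2 (hSnot e' h1).1 hres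
          (residual_inl_of_lt (hcap' e' he') (h3.trans_le (hσ' e' h3)))
        linarith
    · rw [hy'O e' h1]
      simp only [hq, if_pos h1]
      rcases (hτ e').1.eq_or_lt with h3 | h3
      · rw [← h3]; simp
      · refine le_trans (add_le_add_right ?_ _)
          (ih _ e' η (τ e') (y e') hother h3.le ((hτ e').2 h3))
        refine EReal.coe_le_coe_iff.2 (mul_le_mul_of_nonneg_right ?_ h3.le)
        have hlpos : 0 < l := h3.trans_le
          (Finset.single_le_sum (f := τ) (fun e' _ => (hτ e').1) h1)
        have := hΔ.opposite_side t i e e' η b hi he h1 hres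
          (residual_inl_of_lt (hcap' e' he') (h3.trans_le ((hτ e').2 h3)))
          (residual_inr_of_lt hy hi (hlpos.trans_le (hτload hlpos)))
        linarith
  have hqsum : ∑ e' ∈ S.erase e ∪ O, q e' = K * θ - ν * l := by
    have hqS : ∀ e' ∈ S.erase e, q e' = K * σ e' := fun e' h =>
      if_neg (Finset.disjoint_left.1 hSO' h)
    have hqO : ∀ e' ∈ O, q e' = (K - ν) * τ e' := fun e' h => if_pos h
    rw [Finset.sum_union hSO', Finset.sum_congr rfl hqS, Finset.sum_congr rfl hqO,
      ← Finset.mul_sum, ← Finset.mul_sum, ← hθsum]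
    ring
  have hsumle := Finset.sum_le_sum hmsg
  rw [Finset.sum_add_distrib, ← EReal.coe_sum_real, hqsum] at hsumle
  have hpen := hκ.mul_penalty_le hy hi hl0 hτload
  rw [← hν, ← hload'] at hpen
  rw [updateCost, updateCost, hinc, nodeFun_of_conserves hi hcons, nodeFun_of_conserves hi hcons']
  have hKθ : ((K * θ : ℝ) : EReal) = ((ν * l : ℝ) : EReal) + ((K * θ - ν * l : ℝ) : EReal) := by
    rw [← EReal.coe_add]; congr 1; ring
  rw [hKθ, add_add_add_comm, ← EReal.coe_add]
  exact add_le_add (EReal.coe_le_coe_iff.2 hpen) hsumle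

/-- Every finite-cost candidate for `z` is rerouted to a candidate for the point nearer to `x e`,
cheaper by the required amount, so the infima compare without being attained. -/
theorem message_add_le {x : N.Edge → ℝ} (hx : N.Feasible x) {κ κ' : V → ℝ}
    (hκ : N.PenaltySlopes x κ κ') {Δ : ℕ → V → N.Edge → Bool → ℝ}
    (hΔ : N.IsSlopeBound x κ κ' Δ) (t : ℕ) (i : V) (e : N.Edge) (η : Bool) (θ z : ℝ)
    (he : ∃ b, e ∈ N.sideEdges i b) (hθ : 0 ≤ θ) (h : θ ≤ dirSign η * (z - x e)) :
    N.message t i e (z - dirSign η * θ) + ((Δ t i e η * θ : ℝ) : EReal) ≤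
      N.message t i e z := by
  induction t generalizing i e η θ z with
  | zero =>
    by_cases hz : 0 ≤ z ∧ z ≤ N.cap e
    · rw [message_zero, message_zero, edgeFun_of_mem hz,
        edgeFun_of_mem (sub_dirSign_mul_mem hθ h (hx.2 e) hz), ← EReal.coe_add,
        EReal.coe_le_coe_iff]
      have := mul_le_mul_of_nonneg_right (hΔ.zero i e η) hθ
      rw [arcCost_inl] at this
      linarith
    · rw [message_eq_top _ _ hz]
      exact le_top
  | succ t ih =>
    by_cases hz : 0 ≤ z ∧ z ≤ N.cap e
    swap
    · rw [message_eq_top _ _ hz]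
      exact le_top
    rcases hθ.eq_or_lt with rfl | hθ'
    · simp
    have hres : N.Residual x (.inl e, η) := residual_inl_of_lt hz (hθ'.trans_le h)
    obtain ⟨b, hb⟩ := he
    by_cases hi : i ∈ N.Vs
    swap
    · rw [message_of_notMem _ hi, message_of_notMem _ hi, edgeFun_of_mem hz,
        edgeFun_of_mem (sub_dirSign_mul_mem hθ h (hx.2 e) hz), ← EReal.coe_add,
        EReal.coe_le_coe_iff]
      have := mul_le_mul_of_nonneg_right (hΔ.destination (t + 1) i e η b hi hb hres) hθ
      rw [arcCost_inl] at this
      linarith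
    have hinf : N.updateInf t i e (z - dirSign η * θ) +
        (((Δ (t + 1) i e η - N.arcCost κ κ' (.inl e, η)) * θ : ℝ) : EReal) ≤
        N.updateInf t i e z := by
      refine le_iInf₂ fun y hy => ?_
      obtain ⟨hy, rfl⟩ := hy
      by_cases hcons : N.Conserves y i
      swap
      · rw [updateCost_eq_top_of_not_conserves t hi e hcons]
        exact le_top
      by_cases hcap : ∀ e' ∈ (N.incEdges i).erase e, y e' ≤ N.cap e'
      swap
      · push Not at hcap
        obtain ⟨e', he', hlt⟩ := hcap
        rw [updateCost_eq_top_of_exceeds t hi e hy he' (fun h => not_le.2 hlt h.2)]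
        exact le_top
      obtain ⟨y', hy', hye', hle⟩ := exists_updateCost_add_le hx hκ hΔ t ih hi hb hres hθ hy
        hz.2 hcons hcap h
      exact (add_le_add_left (iInf₂_le y' ⟨hy', hye'⟩) _).trans hle
    rw [message_succ_of_mem t hi, message_succ_of_mem t hi, edgeFun_of_mem hz,
      edgeFun_of_mem (sub_dirSign_mul_mem hθ h (hx.2 e) hz)]
    have hsplit : ((Δ (t + 1) i e η * θ : ℝ) : EReal) =
        ((N.arcCost κ κ' (.inl e, η) * θ : ℝ) : EReal) +
          (((Δ (t + 1) i e η - N.arcCost κ κ' (.inl e, η)) * θ : ℝ) : EReal) := by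
      rw [← EReal.coe_add]; congr 1; ring
    rw [hsplit, add_add_add_comm, ← EReal.coe_add]
    refine add_le_add (EReal.coe_le_coe_iff.2 (le_of_eq ?_)) hinf
    rw [arcCost_inl]
    ring

end RoutingNetwork

/-! ### From potentials to strict minima of beliefs -/

namespace RoutingNetwork

variable {V : Type*} [Fintype V] [DecidableEq V] {N : RoutingNetwork V}

theorem decide_snd_eq_of_mem_sideEdges {i : V} {b : Bool} {e : N.Edge}
    (he : e ∈ N.sideEdges i b) : decide (e.1.2 = i) = b := by
  have := fst_ne_snd e
  cases b
  · simp only [sideEdges, Bool.false_eq_true, if_false, mem_outEdges] at he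
    simpa [← he] using this.symm
  · simp only [sideEdges, if_true, mem_inEdges] at he
    simpa using he

theorem decide_snd_eq_otherEnd_of_mem_sideEdges {i : V} {b : Bool} {e : N.Edge}
    (he : e ∈ N.sideEdges i b) : decide (e.1.2 = N.otherEnd i e) = !b := by
  have := fst_ne_snd e
  cases b
  · simp only [sideEdges, Bool.false_eq_true, if_false, mem_outEdges] at he
    simp [otherEnd, he]
  · simp only [sideEdges, if_true, mem_inEdges] at he
    have h : e.1.1 ≠ i := fun h => this (h.trans he.symm)
    simpa [otherEnd, h] using this.symm

theorem arcHead_inl_of_mem_sideEdges {i : V} (hi : i ∈ N.Vs) {η : Bool} {e : N.Edge}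
    (he : e ∈ N.sideEdges i η) :
    arcHead N.splitSrc N.splitDst (.inl e, η) = some (i, !η) := by
  cases η <;> simp only [sideEdges, if_true, Bool.false_eq_true, if_false, mem_inEdges,
    mem_outEdges] at he <;> simp [arcHead, splitSrc, splitDst, he, hi]

theorem arcTail_inl_of_mem_sideEdges {i : V} (hi : i ∈ N.Vs) {η : Bool} {e : N.Edge}
    (he : e ∈ N.sideEdges i (!η)) :
    arcTail N.splitSrc N.splitDst (.inl e, η) = some (i, η) := by
  cases η <;> simp only [sideEdges, if_true, Bool.false_eq_true, if_false, mem_inEdges,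
    mem_outEdges, Bool.not_true, Bool.not_false] at he <;> simp [arcTail, splitSrc, splitDst, he, hi]

theorem arcHead_inl_of_notMem {i : V} (hi : i ∉ N.Vs) {η : Bool} {e : N.Edge}
    (he : e ∈ N.sideEdges i η) :
    arcHead N.splitSrc N.splitDst (.inl e, η) = none := by
  cases η <;> simp only [sideEdges, if_true, Bool.false_eq_true, if_false, mem_inEdges,
    mem_outEdges] at he <;> simp [arcHead, splitSrc, splitDst, he, hi]

theorem arcTail_inl_of_notMem {i : V} (hi : i ∉ N.Vs) {η : Bool} {e : N.Edge}
    (he : e ∈ N.sideEdges i (!η)) :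
    arcTail N.splitSrc N.splitDst (.inl e, η) = none := by
  cases η <;> simp only [sideEdges, if_true, Bool.false_eq_true, if_false, mem_inEdges,
    mem_outEdges, Bool.not_true, Bool.not_false] at he <;> simp [arcTail, splitSrc, splitDst, he, hi]

theorem arcHead_inr (i : V) (η : Bool) :
    arcHead N.splitSrc N.splitDst (.inr i, η) = some (i, η) := by
  cases η <;> rfl

theorem arcTail_inr (i : V) (η : Bool) :
    arcTail N.splitSrc N.splitDst (.inr i, η) = some (i, !η) := by
  cases η <;> rfl

theorem exists_isSlopeBound {x : N.Edge → ℝ} {κ κ' : V → ℝ}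
    (H : CirculationsPos N.splitSrc N.splitDst (N.Residual x) (N.arcCost κ κ')) :
    ∃ Δ, N.IsSlopeBound x κ κ' Δ ∧ ∃ T : ℕ, ∀ t, T ≤ t → ∀ (e : N.Edge) (η : Bool),
      N.arcCost κ κ' (.inl e, η) < Δ t e.1.1 e η + Δ t e.1.2 e η := by
  obtain ⟨ε, hε, ρ, hρ⟩ := exists_nonBacktracking_potential N.splitSrc N.splitDst none _ _ H
  obtain ⟨fwd, bwd, hf0, hb0, hfm, hbm, hft, hbi, hfs, hbs, T, hT⟩ :=
    exists_step_bounds (NonBacktracking N.splitSrc N.splitDst none (N.Residual x))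
      (fun a => N.Residual x a ∧ arcHead N.splitSrc N.splitDst a = none)
      (fun a => N.Residual x a ∧ arcTail N.splitSrc N.splitDst a = none) (N.arcCost κ κ') ρ hε hρ
      (fun a b ha hb => hρ a b ⟨ha.1, hb.1, ha.2.trans hb.2.symm, Or.inr ha.2⟩)
  -- If the arc `(e, η)` points into `i`, the deviation continues beyond its head and `fwd` applies;
  -- otherwise it is traced back from its tail and `bwd` applies. The two ends of `e` thus receive
  -- one of each.
  refine ⟨fun t i e η =>
    if decide (e.1.2 = i) = η then fwd t (.inl e, η) else bwd t (.inl e, η), ⟨?_, ?_, ?_, ?_⟩,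
    T, fun t ht e η => ?_⟩
  · intro i e η
    split_ifs
    exacts [hf0 _, hb0 _]
  · intro t i e η b hi he hres
    rw [decide_snd_eq_of_mem_sideEdges he]
    split_ifs with h
    · subst h
      exact hft t _ ⟨hres, arcHead_inl_of_notMem hi he⟩
    · rw [Bool.eq_not_of_ne h] at he
      exact hbi t _ ⟨hres, arcTail_inl_of_notMem hi he⟩
  · intro t i e e' η b hi he he' hne hres hres'
    rw [decide_snd_eq_of_mem_sideEdges he, decide_snd_eq_otherEnd_of_mem_sideEdges he']
    split_ifs with h h' h'
    · subst h
      refine hfs t _ _ ⟨hres, hres', ?_, Or.inl ?_⟩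
      · rw [arcHead_inl_of_mem_sideEdges hi he,
          arcTail_inl_of_mem_sideEdges hi (by rwa [Bool.not_not])]
      · simp [arcRev, hne]
    · exact (h' (by rw [h])).elim
    · exact (h (Bool.not_inj h')).elim
    · obtain rfl := Bool.eq_not_of_ne h
      refine hbs t _ _ ⟨hres', hres, ?_, Or.inl ?_⟩
      · rw [arcHead_inl_of_mem_sideEdges hi he', arcTail_inl_of_mem_sideEdges hi he, Bool.not_not]
      · simp [arcRev, hne.symm]
  · intro t i e e' η b hi he he' hres hres' hresi
    rw [decide_snd_eq_of_mem_sideEdges he, decide_snd_eq_otherEnd_of_mem_sideEdges he',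
      Bool.not_not]
    split_ifs with h
    · subst h
      have h1 := hfs t (.inl e, b) (.inr i, b) ⟨hres, hresi, by
        rw [arcHead_inl_of_mem_sideEdges hi he, arcTail_inr], Or.inl (by simp [arcRev])⟩
      have h2 := hfs t (.inr i, b) (.inl e', b) ⟨hresi, hres', by
        rw [arcTail_inl_of_mem_sideEdges hi he', arcHead_inr], Or.inl (by simp [arcRev])⟩
      -- Crossing a node takes two arcs of the split graph but one iteration; monotonicity in `t`
      -- makes up the difference.
      linarith [hfm t (.inr i, b)]
    · obtain rfl := Bool.eq_not_of_ne h
      rw [Bool.not_not] at he'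
      have h1 := hbs t (.inr i, η) (.inl e, η) ⟨hresi, hres, by
        rw [arcTail_inl_of_mem_sideEdges hi he, arcHead_inr], Or.inl (by simp [arcRev])⟩
      have h2 := hbs t (.inl e', η) (.inr i, η) ⟨hres', hresi, by
        rw [arcHead_inl_of_mem_sideEdges hi he', arcTail_inr], Or.inl (by simp [arcRev])⟩
      linarith [hbm t (.inr i, η)]
  · have h := hT t ht (.inl e, η)
    have h1 : decide (e.1.2 = e.1.1) = false := by simpa using (fst_ne_snd e).symm
    beta_reduce
    rw [h1, decide_eq_true (rfl : e.1.2 = e.1.2)]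
    cases η
    · simpa using h
    · simpa [add_comm] using h

theorem Feasible.belief_ne_top {x : N.Edge → ℝ} (hx : N.Feasible x) (t : ℕ) (e : N.Edge) :
    N.belief t e (x e) ≠ ⊤ := by
  rw [belief, if_pos (hx.2 e), edgeFun_of_mem (hx.2 e), sub_eq_add_neg, ← EReal.coe_neg]
  exact EReal.add_ne_top (EReal.add_ne_top (hx.message_ne_top _ _ _) (hx.message_ne_top _ _ _))
    (EReal.coe_ne_top _)

/-- Moving from `x e` to `z` raises the two messages at rates whose sum exceeds the slope of the
subtracted `g_e`. -/
theorem belief_lt_belief {x : N.Edge → ℝ} (hx : N.Feasible x) {κ κ' : V → ℝ}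
    (hκ : N.PenaltySlopes x κ κ') {Δ : ℕ → V → N.Edge → Bool → ℝ}
    (hΔ : N.IsSlopeBound x κ κ' Δ) {t : ℕ} {e : N.Edge}
    (hpos : ∀ η, N.arcCost κ κ' (.inl e, η) < Δ t e.1.1 e η + Δ t e.1.2 e η)
    {z : ℝ} (hz : z ≠ x e) : N.belief t e (x e) < N.belief t e z := by
  by_cases hzu : 0 ≤ z ∧ z ≤ N.cap e
  swap
  · rw [show N.belief t e z = ⊤ from if_neg hzu]
    exact lt_top_iff_ne_top.2 (hx.belief_ne_top t e)
  obtain ⟨η, θ, hθ, hzθ⟩ : ∃ η : Bool, ∃ θ > 0, z = x e + dirSign η * θ := by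
    rcases lt_or_gt_of_ne hz with h | h
    · exact ⟨false, x e - z, sub_pos.2 h, by simp [dirSign]⟩
    · exact ⟨true, z - x e, sub_pos.2 h, by simp [dirSign]⟩
  have hθz : θ = dirSign η * (z - x e) := by
    rw [hzθ, add_sub_cancel_left, ← mul_assoc, dirSign_mul_self, one_mul]
  have hback : z - dirSign η * θ = x e := by rw [hzθ]; ring
  have h1 := message_add_le hx hκ hΔ t e.1.1 e η θ z ⟨false, by simp [sideEdges, mem_outEdges]⟩
    hθ.le hθz.le
  have h2 := message_add_le hx hκ hΔ t e.1.2 e η θ z ⟨true, by simp [sideEdges, mem_inEdges]⟩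
    hθ.le hθz.le
  rw [hback] at h1 h2
  rw [belief, belief, if_pos (hx.2 e), if_pos hzu, edgeFun_of_mem (hx.2 e), edgeFun_of_mem hzu]
  lift N.message t e.1.1 e (x e) to ℝ using
    ⟨hx.message_ne_top t _ e, message_ne_bot _ _ _ _⟩ with m₁
  lift N.message t e.1.2 e (x e) to ℝ using
    ⟨hx.message_ne_top t _ e, message_ne_bot _ _ _ _⟩ with m₂
  refine lt_of_lt_of_le ?_ (EReal.sub_le_sub (add_le_add h1 h2) le_rfl)
  norm_cast
  have h3 := mul_lt_mul_of_pos_right (hpos η) hθ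
  rw [arcCost_inl] at h3
  rw [hzθ]
  linarith

end RoutingNetwork

/-- If the balanced routing problem has the unique optimal solution `xstar`, then after finitely
many iterations the belief minimizers exist, are unique, and form the flow `xstar`. -/
theorem proposition2 {V : Type*} [Fintype V] [DecidableEq V] (N : RoutingNetwork V)
    (xstar : N.Edge → ℝ) (hopt : N.IsOptimal xstar)
    (huniq : ∀ x : N.Edge → ℝ, N.IsOptimal x → x = xstar) :
    ∃ T : ℕ, ∀ t : ℕ, T ≤ t → ∀ xhat : N.Edge → ℝ, N.IsOutput t xhat ↔ xhat = xstar := by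
  obtain ⟨κ, κ', hκ⟩ := hopt.1.exists_penaltySlopes
  obtain ⟨Δ, hΔ, T, hT⟩ := RoutingNetwork.exists_isSlopeBound
    (RoutingNetwork.circulationsPos_of_unique hopt huniq hκ)
  have hlt : ∀ t, T ≤ t → ∀ e z, z ≠ xstar e → N.belief t e (xstar e) < N.belief t e z :=
    fun t ht e z hz => RoutingNetwork.belief_lt_belief hopt.1 hκ hΔ (hT t ht e) hz
  refine ⟨T, fun t ht xhat => ⟨fun h => ?_, ?_⟩⟩
  · funext e
    by_contra hne
    exact (hlt t ht e _ hne).not_ge (h e _)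
  · rintro rfl e z
    by_cases hz : z = xhat e
    · rw [hz]
    · exact (hlt t ht e z hz).le
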